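/- Let $q_0\in L^2([0,1])$ be real-valued and even, i.e. $q_0(x)=q_0(1-x)$ for almost every $x$. Let $G$ be the honeycomb graph with edges of length $1$, invariant under the $\mathbb Z^2$-shifts by $\vec e_1=(3/2,\sqrt3/2)$ and $\vec e_2=(0,\sqrt3)$. Its vertices are the translates of $a=(0,0)$ and $b=(1/2,\sqrt3/2)$. Its edges are the translates of the edges $f,g,h$ that lead from $a$ to $b$, $b-\vec e_1$, $b-\vec e_2$, respectively. Each edge is identified with $[0,1]$. For $\theta=(\theta_1,\theta_2)\in[-\pi,\pi]^2$ let $H^\theta$ be the Bloch Hamiltonian in $L^2(f)\oplus L^2(g)\oplus L^2(h)$. It acts as $u\mapsto -u''+q_0u$ on each edge. Its domain consists of the restrictions to $f,g,h$ of the functions $u$ on $G$ that are in $H^2$ on each edge, are continuous at each vertex, have outgoing derivatives summing to zero at each vertex, and satisfy $u(x+p_1\vec e_1+p_2\vec e_2)=e^{i(p_1\theta_1+p_2\theta_2)}u(x)$ for all $p\in\mathbb Z^2$ and $x\in G$. The dispersion relation of the graphene operator is the set $$\mathcal B=\{(\theta,\lambda)\in[-\pi,\pi]^2\times\mathbb R:\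 \lambda\in\sigma(H^\theta)\}.$$ Let $D(\lambda)=\operatorname{tr}M(\lambda)$ be the discriminant, where $M(\lambda)$ is the monodromy matrix of $-\phi''+q_0\phi=\lambda\phi$ on $[0,1]$, i.e. $(\phi(1),\phi'(1))^{T}=M(\lambda)(\phi(0),\phi'(0))^{T}$ for every solution $\phi$. We say that $\mathcal B$ has a conical singularity at $(\theta_0,\lambda_0)$ if there are a positive definite quadratic form $Q$ on $\mathbb R^2$ and two functions $\lambda_\pm$ that are $C^\infty$ in a punctured neighbourhood of $\theta_0$, such that $$\lambda_\pm(\theta)=\lambda_0\pm\sqrt{Q(\theta-\theta_0)}+O(|\theta-\theta_0|^2)\qquad(\theta\to\theta_0),$$ and in a neighbourhood of $(\theta_0,\lambda_0)$ the set $\mathcal B$ is the union of the graphs of $\lambda_+$ and $\lambda_-$. Then for every $\lambda\in\mathbb R$ with $D(\lambda)=0$, the dispersion relation $\mathcal B$ has conical singularities at level $\lambda$ exactly at the two quasimomenta $\theta=\pm(2\pi/3,-2\pi/3)$. -/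

import Mathlib

open MeasureTheory Set Filter Asymptotics
open scoped Topology ContDiff Real

noncomputable section

namespace Graphene

/-- Lebesgue measure on the unit interval, the coordinate space of every edge. -/
abbrev edgeMeasure : Measure ℝ := volume.restrict (Icc (0 : ℝ) 1)

/-- `φ` belongs to the Sobolev space `H²(0,1)` (taken as its `C¹` representative on `[0,1]`), with
first derivative `φ'` (its absolutely continuous representative) and second weak derivative
`φ'' ∈ L²(0,1)`. -/
structure IsH2 (φ φ' φ'' : ℝ → ℂ) : Prop where
  memLp : MemLp φ'' 2 edgeMeasure
  first : ∀ x ∈ Icc (0 : ℝ) 1, φ x = φ 0 + ∫ t in (0 : ℝ)..x, φ' t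
  second : ∀ x ∈ Icc (0 : ℝ) 1, φ' x = φ' 0 + ∫ t in (0 : ℝ)..x, φ'' t

/-! ### The Hill discriminant -/

/-- `φ`, with derivative `φ'`, solves `-φ'' + q φ = z φ` on one period `[0,1]`. -/
def IsHillSolution (q : ℝ → ℝ) (z : ℂ) (φ φ' : ℝ → ℂ) : Prop :=
  ∃ φ'' : ℝ → ℂ, IsH2 φ φ' φ'' ∧
    ∀ᵐ x ∂edgeMeasure, -φ'' x + (q x : ℂ) * φ x = z * φ x

/-- `M` shifts the Cauchy data of every solution of the Hill equation by one period. -/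
def IsMonodromyMatrix (q : ℝ → ℝ) (z : ℂ) (M : Matrix (Fin 2) (Fin 2) ℂ) : Prop :=
  ∀ φ φ' : ℝ → ℂ, IsHillSolution q z φ φ' → ![φ 1, φ' 1] = M.mulVec ![φ 0, φ' 0]

/-- The monodromy matrix `M(z)`; for `q ∈ L²(0,1)` it is the only matrix with the property
`IsMonodromyMatrix`. -/
def monodromyMatrix (q : ℝ → ℝ) (z : ℂ) : Matrix (Fin 2) (Fin 2) ℂ :=
  Classical.epsilon (IsMonodromyMatrix q z)

/-- The discriminant `D(z) = tr M(z)` of the Hill operator with the `1`-periodic potential `q`. -/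
def discriminant (q : ℝ → ℝ) (z : ℂ) : ℂ := (monodromyMatrix q z).trace

/-! ### The honeycomb graph

The lattice `ℤ²` acts by the shifts `e₁ = (3/2, √3/2)`, `e₂ = (0, √3)`. Vertices are
`a_p = p₁ e₁ + p₂ e₂` and `b_p = a_p + (1/2, √3/2)` for `p ∈ ℤ²`. The three unit-length edges
leaving `a_p` lead to `b_p` (edge `f`), to `b_{p - (1,0)}` (edge `g`) and to `b_{p - (0,1)}`
(edge `h`). Each is parametrized by `[0,1]`, with `0` at its `a`-end and `1` at its `b`-end. -/

/-- The three edges of the fundamental domain. -/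
inductive Bond
  | f
  | g
  | h
  deriving DecidableEq

instance : Fintype Bond := ⟨{.f, .g, .h}, fun i => by cases i <;> simp⟩

/-- The edges of the honeycomb graph: the translates by `ℤ²` of `f`, `g`, `h`. -/
abbrev Edge : Type := (ℤ × ℤ) × Bond

/-- The edge `(p, i)` joins `a_p` to `b_{p - shift i}`. Hence the edges at `b_p` are the
`(p + shift i, i)`. -/
def Bond.shift : Bond → ℤ × ℤ
  | .f => (0, 0)
  | .g => (1, 0)
  | .h => (0, 1)

/-! ### The Bloch Hamiltonians -/

/-- The function `u` on the honeycomb graph (with derivatives `u'`, `u''` along the edges) belongs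
to the domain of the Bloch Hamiltonian with quasimomentum `θ`: it is `H²` on each edge, satisfies
the Neumann (Kirchhoff) conditions at each vertex, i.e. it is continuous and the derivatives in
the outgoing directions add up to zero, and it satisfies the Floquet-Bloch conditions. -/
structure IsBlochFunction (θ : ℝ × ℝ) (u u' u'' : Edge → ℝ → ℂ) : Prop where
  isH2 : ∀ e, IsH2 (u e) (u' e) (u'' e)
  continuous_a : ∀ p, ∃ A : ℂ, ∀ i, u (p, i) 0 = A
  continuous_b : ∀ p, ∃ B : ℂ, ∀ i : Bond, u (p + i.shift, i) 1 = B
  flux_a : ∀ p, ∑ i, u' (p, i) 0 = 0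
  flux_b : ∀ p, ∑ i : Bond, -u' (p + i.shift, i) 1 = 0
  floquet : ∀ (r p : ℤ × ℤ) (i : Bond), ∀ x ∈ Icc (0 : ℝ) 1,
    u (p + r, i) x = Complex.exp (Complex.I * (r.1 * θ.1 + r.2 * θ.2)) * u (p, i) x

/-- The Hilbert space `L²(W)` over the fundamental domain with the edges `f`, `g`, `h`. -/
abbrev L2W : Type := PiLp 2 (fun _ : Bond => Lp ℂ 2 edgeMeasure)

/-- The Bloch Hamiltonian `H^θ`, `u ↦ -u'' + q u`, an unbounded operator in `L²(W)`, given by its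
graph, the set of all pairs `(u, H^θ u)` with `u` in the domain. -/
def blochHamiltonian (q : ℝ → ℝ) (θ : ℝ × ℝ) : Set (L2W × L2W) :=
  {vw | ∃ u u' u'' : Edge → ℝ → ℂ, IsBlochFunction θ u u' u'' ∧
    ∀ i, (∀ᵐ x ∂edgeMeasure, vw.1 i x = u (0, i) x) ∧
      ∀ᵐ x ∂edgeMeasure, vw.2 i x = -u'' (0, i) x + (q x : ℂ) * u (0, i) x}

/-- The spectrum of the unbounded operator `T` with graph `T`: `z` is *not* in it exactly if
`T - z` maps the domain bijectively onto the space with a bounded inverse `R`, that is, `u = R v`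
is the unique solution of `T u = v + z u`. -/
def operatorSpectrum {E : Type*} [NormedAddCommGroup E] [NormedSpace ℂ E] (T : Set (E × E)) :
    Set ℂ :=
  {z | ¬ ∃ R : E →L[ℂ] E, ∀ u v : E, (u, v + z • u) ∈ T ↔ u = R v}

/-- The Brillouin zone `[-π, π]²`. -/
def brillouinZone : Set (ℝ × ℝ) := Icc (-π) π ×ˢ Icc (-π) π

/-- The dispersion relation (Bloch variety) of the graphene operator: the graph of the
multivalued function `θ ↦ σ(H^θ)` on the Brillouin zone. -/
def dispersionRelation (q : ℝ → ℝ) : Set ((ℝ × ℝ) × ℝ) :=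
  {x | x.1 ∈ brillouinZone ∧ (x.2 : ℂ) ∈ operatorSpectrum (blochHamiltonian q x.1)}

/-- The set `S ⊆ ℝ² × ℝ` has a conical singularity at `(θ₀, l₀)`: near this point it is the union
of the graphs of two functions `lp`, `lm`, smooth off `θ₀`, with
`lp θ = l₀ + √Q(θ - θ₀) + O(|θ - θ₀|²)` and `lm θ = l₀ - √Q(θ - θ₀) + O(|θ - θ₀|²)` for some
positive definite quadratic form `Q`. -/
def HasConicalSingularity (S : Set ((ℝ × ℝ) × ℝ)) (θ₀ : ℝ × ℝ) (l₀ : ℝ) : Prop :=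
  ∃ (Q : QuadraticForm ℝ (ℝ × ℝ)) (lp lm : ℝ × ℝ → ℝ), Q.PosDef ∧
    (fun θ => lp θ - (l₀ + √(Q (θ - θ₀)))) =O[𝓝 θ₀] (fun θ => ‖θ - θ₀‖ ^ 2) ∧
    (fun θ => lm θ - (l₀ - √(Q (θ - θ₀)))) =O[𝓝 θ₀] (fun θ => ‖θ - θ₀‖ ^ 2) ∧
    (∀ᶠ θ in 𝓝[≠] θ₀, ContDiffAt ℝ ∞ lp θ ∧ ContDiffAt ℝ ∞ lm θ) ∧
    ∀ᶠ x in 𝓝 (θ₀, l₀), x ∈ S ↔ x.2 = lp x.1 ∨ x.2 = lm x.1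

end Graphene

end

/-! Let `c, s` be the solutions of the Hill equation on one edge with Cauchy data `(1,0)` and
`(0,1)` at `0`, and write `c, s, c', s'` also for their values and derivatives at `1`. If `s ≠ 0`,
the resolvent equation `(H^θ - z)U = V` reduces to a linear system for the two vertex values `A, B`:
the ODE is solved on each edge by a Volterra series, and the slopes at `0` are eliminated through
the values at `1`. With `F(θ) = 1 + e^{iθ₁} + e^{iθ₂}`, the determinant of the system is `|F(θ)|² -
9 c s'`. Hence `z ∈ σ(H^θ)` iff `|F(θ)|² = 9 c s'` (`mem_spectrum_iff`).

For even `q`, reflection of the edge gives `c = s'`, so both equal `η = D/2`, and the dispersion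
relation reads `η(λ) = ±|F(θ)|/3` (`mem_dispersionRelation_iff`). At a zero `l` of `D`, reflection
and the Wronskian identity give `s ≠ 0` (`sinSol_ne_zero`), and Lagrange's identity gives `η'(l) ≠
0` (`eta_deriv_ne_zero`). With `g` the local inverse of `η`, the two sheets are `λ = g(±|F(θ)|/3)`.

In the Brillouin zone `F` vanishes at exactly two points, and there its differential has squared
modulus `x₁² - x₁x₂ + x₂²`, a positive definite form. Expanding `g` to first order yields the cone.
Conversely, the apex of a cone at level `l` lies on the dispersion relation, so `η(l) = 0` forces `F
= 0` there. -/

noncomputable section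

namespace Graphene

/-! ### Integral operators on one edge -/

/-- The continuous functions on one edge. -/
abbrev C01 : Type := C(Icc (0 : ℝ) 1, ℂ)

/-- The square integrable functions on one edge. -/
abbrev L2E : Type := Lp ℂ 2 edgeMeasure

instance : IsProbabilityMeasure edgeMeasure := ⟨by simp [edgeMeasure]⟩

/-- The extension of a continuous function on `[0,1]` to the real line by constants. -/
def extend (φ : C01) : ℝ → ℂ := IccExtend zero_le_one φ

theorem continuous_extend (φ : C01) : Continuous (extend φ) := φ.continuous.Icc_extend'

theorem extend_of_mem (φ : C01) {x : ℝ} (hx : x ∈ Icc (0 : ℝ) 1) : extend φ x = φ ⟨x, hx⟩ :=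
  IccExtend_of_mem _ _ hx

theorem norm_extend_le (φ : C01) (x : ℝ) : ‖extend φ x‖ ≤ ‖φ‖ := φ.norm_coe_le_norm _

theorem memLp_mul_extend (w : L2E) (φ : C01) :
    MemLp (fun x => w x * extend φ x) 2 edgeMeasure :=
  (Lp.memLp w).of_le_mul (c := ‖φ‖)
    ((Lp.aestronglyMeasurable w).mul (continuous_extend φ).aestronglyMeasurable)
    (Eventually.of_forall fun x => by
      rw [norm_mul, mul_comm]
      exact mul_le_mul_of_nonneg_right (norm_extend_le φ x) (norm_nonneg _))

/-- Multiplication by a square integrable function, from `C([0,1])` to `L²(0,1)`. -/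
def mulOp (w : L2E) : C01 →L[ℂ] L2E :=
  LinearMap.mkContinuous
    { toFun := fun φ => (memLp_mul_extend w φ).toLp
      map_add' := fun φ ψ => by
        rw [← MemLp.toLp_add]
        refine MemLp.toLp_congr _ _ (Eventually.of_forall fun x => ?_)
        simp [extend, IccExtend, mul_add]
      map_smul' := fun c φ => by
        rw [RingHom.id_apply, ← MemLp.toLp_const_smul]
        refine MemLp.toLp_congr _ _ (Eventually.of_forall fun x => ?_)
        simp [extend, IccExtend, mul_left_comm] }
    ‖w‖ fun φ => by
      rw [mul_comm]
      refine Lp.norm_le_mul_norm_of_ae_le_mul ?_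
      filter_upwards [(memLp_mul_extend w φ).coeFn_toLp] with x hx
      rw [LinearMap.coe_mk, AddHom.coe_mk, hx, norm_mul, mul_comm]
      exact mul_le_mul_of_nonneg_right (norm_extend_le φ x) (norm_nonneg _)

theorem coeFn_mulOp (w : L2E) (φ : C01) :
    mulOp w φ =ᵐ[edgeMeasure] fun x => w x * extend φ x :=
  (memLp_mul_extend w φ).coeFn_toLp

theorem integrable_L2E (f : L2E) : Integrable f edgeMeasure :=
  (Lp.memLp f).integrable (by norm_num)

theorem intervalIntegrable_of_integrable {f : ℝ → ℂ} (hf : Integrable f edgeMeasure) {a b : ℝ}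
    (ha : a ∈ Icc (0 : ℝ) 1) (hb : b ∈ Icc (0 : ℝ) 1) : IntervalIntegrable f volume a b := by
  have h : IntegrableOn f (Icc 0 1) volume := hf
  exact (h.mono_set (uIcc_subset_Icc ha hb)).intervalIntegrable

theorem integral_norm_L2E_le (f : L2E) : ∫ t, ‖f t‖ ∂edgeMeasure ≤ ‖f‖ := by
  rw [integral_norm_eq_lintegral_enorm (Lp.aestronglyMeasurable f), ← eLpNorm_one_eq_lintegral_enorm,
    Lp.norm_def]
  exact ENNReal.toReal_mono (Lp.eLpNorm_ne_top f)
    (eLpNorm_le_eLpNorm_of_exponent_le (by norm_num) (Lp.aestronglyMeasurable f))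

theorem norm_integral_L2E_le (f : L2E) {x : ℝ} (hx : x ∈ Icc (0 : ℝ) 1) :
    ∫ t in (0 : ℝ)..x, ‖f t‖ ≤ ‖f‖ := by
  refine le_trans ?_ (integral_norm_L2E_le f)
  rw [intervalIntegral.integral_of_le hx.1]
  refine setIntegral_mono_set (s := Ioc 0 x) (t := Icc 0 1) (integrable_L2E f).norm
    (Eventually.of_forall fun _ => norm_nonneg _) (LE.le.eventuallyLE ?_)
  exact fun t ht => ⟨ht.1.le, ht.2.trans hx.2⟩

theorem continuousOn_primitive_L2E (f : L2E) :
    ContinuousOn (fun x => ∫ t in (0 : ℝ)..x, f t) (Icc 0 1) := by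
  have h : IntegrableOn f (Icc 0 1) volume := integrable_L2E f
  exact intervalIntegral.continuousOn_primitive_interval (by rwa [uIcc_of_le zero_le_one])
    |>.mono (by rw [uIcc_of_le zero_le_one])

/-- The restriction to `[0,1]` of a function that is continuous there. -/
def restrictC {f : ℝ → ℂ} (hf : ContinuousOn f (Icc 0 1)) : C01 := ⟨fun x => f x, hf.domRestrict⟩

theorem restrictC_apply {f : ℝ → ℂ} (hf : ContinuousOn f (Icc 0 1)) (x : Icc (0 : ℝ) 1) :
    restrictC hf x = f x := rfl

/-- The antiderivative vanishing at `0`, from `L²(0,1)` to `C([0,1])`. -/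
def intOp : L2E →L[ℂ] C01 :=
  LinearMap.mkContinuous
    { toFun := fun f => restrictC (continuousOn_primitive_L2E f)
      map_add' := fun f g => by
        ext x
        have h0 : (0 : ℝ) ∈ Icc (0 : ℝ) 1 := ⟨le_rfl, zero_le_one⟩
        simp only [restrictC_apply, ContinuousMap.add_apply]
        rw [← intervalIntegral.integral_add
          (intervalIntegrable_of_integrable (integrable_L2E f) h0 x.2)
          (intervalIntegrable_of_integrable (integrable_L2E g) h0 x.2)]
        refine intervalIntegral.integral_congr_ae ?_
        have := (ae_restrict_iff' measurableSet_Icc).1 (Lp.coeFn_add f g)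
        filter_upwards [this] with t ht hmem
        rw [uIoc_of_le x.2.1] at hmem
        exact ht ⟨hmem.1.le, hmem.2.trans x.2.2⟩
      map_smul' := fun c f => by
        ext x
        simp only [restrictC_apply, ContinuousMap.smul_apply, RingHom.id_apply]
        rw [← intervalIntegral.integral_smul]
        refine intervalIntegral.integral_congr_ae ?_
        have := (ae_restrict_iff' measurableSet_Icc).1 (Lp.coeFn_smul c f)
        filter_upwards [this] with t ht hmem
        rw [uIoc_of_le x.2.1] at hmem
        exact ht ⟨hmem.1.le, hmem.2.trans x.2.2⟩ }
    1 fun f => by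
      rw [one_mul, ContinuousMap.norm_le _ (norm_nonneg _)]
      exact fun x => (intervalIntegral.norm_integral_le_integral_norm x.2.1).trans
        (norm_integral_L2E_le f x.2)

theorem intOp_apply (f : L2E) (x : Icc (0 : ℝ) 1) : intOp f x = ∫ t in (0 : ℝ)..x, f t := rfl

/-- Interval integrals over subintervals of `[0,1]` depend only on the class of the integrand. -/
theorem integral_congr_edge {f g : ℝ → ℂ} (h : f =ᵐ[edgeMeasure] g) {x : ℝ}
    (hx : x ∈ Icc (0 : ℝ) 1) : ∫ t in (0 : ℝ)..x, f t = ∫ t in (0 : ℝ)..x, g t := by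
  refine intervalIntegral.integral_congr_ae ?_
  have := (ae_restrict_iff' measurableSet_Icc).1 h
  filter_upwards [this] with t ht hmem
  rw [uIoc_of_le hx.1] at hmem
  exact ht ⟨hmem.1.le, hmem.2.trans hx.2⟩

/-- The constant function `1` in `L²(0,1)`. -/
def one2 : L2E := (memLp_const (1 : ℂ)).toLp

theorem coeFn_one2 : one2 =ᵐ[edgeMeasure] fun _ => 1 := MemLp.coeFn_toLp _

/-- The Volterra operator `φ ↦ ∫₀ˣ ∫₀ᵗ w φ`. -/
def volterra (w : L2E) : C01 →L[ℂ] C01 := intOp ∘L mulOp one2 ∘L intOp ∘L mulOp w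

theorem coeFn_mulOp_one2 (φ : C01) : mulOp one2 φ =ᵐ[edgeMeasure] extend φ := by
  filter_upwards [coeFn_mulOp one2 φ, coeFn_one2] with x h1 h2
  rw [h1, h2, one_mul]

theorem norm_intOp_mulOp_le (w : L2E) (φ : C01) (x : Icc (0 : ℝ) 1) {C : ℝ}
    (hC : ∀ t : Icc (0 : ℝ) 1, t ≤ x → ‖φ t‖ ≤ C) : ‖intOp (mulOp w φ) x‖ ≤ C * ‖w‖ := by
  have h0 : (0 : ℝ) ∈ Icc (0 : ℝ) 1 := ⟨le_rfl, zero_le_one⟩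
  have hC0 : 0 ≤ C := (norm_nonneg _).trans (hC ⟨0, h0⟩ x.2.1)
  rw [intOp_apply, integral_congr_edge (coeFn_mulOp w φ) x.2]
  calc _ ≤ ∫ t in (0 : ℝ)..x, C * ‖w t‖ := by
        refine intervalIntegral.norm_integral_le_of_norm_le x.2.1
          (Eventually.of_forall fun t ht => ?_)
          ((intervalIntegrable_of_integrable (integrable_L2E w) h0 x.2).norm.const_mul C)
        have ht' : t ∈ Icc (0 : ℝ) 1 := ⟨ht.1.le, ht.2.trans x.2.2⟩
        rw [norm_mul, mul_comm, extend_of_mem φ ht']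
        exact mul_le_mul_of_nonneg_right (hC _ ht.2) (norm_nonneg _)
    _ ≤ _ := by
        rw [intervalIntegral.integral_const_mul]
        exact mul_le_mul_of_nonneg_left (norm_integral_L2E_le w x.2) hC0

/-- The function `e^{kx}` on `[0,1]`. -/
def expC (k : ℝ) : C01 := ⟨fun x => Real.exp (k * x), by fun_prop⟩

theorem expC_mul_neg (k : ℝ) : expC k * expC (-k) = 1 := by
  ext x
  simp [expC, ← Complex.exp_add]

theorem one_sub_eq_conj {R : Type*} [Ring R] {a b : R} (hab : a * b = 1) (v : R) :
    1 - v = a * (1 - b * v * a) * b := by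
  have : a * (1 - b * v * a) * b = a * b - (a * b) * v * (a * b) := by noncomm_ring
  rw [this, hab, one_mul, mul_one]

/-- Conjugation by the weight `e^{kx}` (an equivalent weighted sup norm) brings the norm of the
Volterra operator down to at most `‖w‖ / k`. With `k = ‖w‖ + 1` this is below `1`, and a Neumann
series applies for every `w`, large or small. -/
theorem isUnit_one_sub_volterra (w : L2E) : IsUnit (1 - volterra w) := by
  set k : ℝ := ‖w‖ + 1 with hk
  have hk0 : 0 < k := by positivity
  let E : ℝ → C01 →L[ℂ] C01 := fun k => ContinuousLinearMap.mul ℂ C01 (expC k)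
  have hE : E k * E (-k) = 1 := by
    ext1 φ
    simp [E, ← mul_assoc, expC_mul_neg]
  have hE' : E (-k) * E k = 1 := by
    ext1 φ
    have := expC_mul_neg (-k)
    rw [neg_neg] at this
    simp [E, ← mul_assoc, this]
  have hn : ‖E (-k) * volterra w * E k‖ < 1 := by
    refine lt_of_le_of_lt (ContinuousLinearMap.opNorm_le_bound _ (M := ‖w‖ / k) (by positivity)
      fun φ => ?_) ((div_lt_one hk0).2 (by linarith))
    rw [ContinuousMap.norm_le _ (by positivity)]
    intro x
    -- The inner integration costs a factor `‖w‖`, since `e^{kt}` is increasing; the outer integral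
    -- of `e^{kt}` then gains the factor `1 / k`.
    have h1 : ∀ t : Icc (0 : ℝ) 1,
        ‖intOp (mulOp w (expC k * φ)) t‖ ≤ (Real.exp (k * t) * ‖φ‖) * ‖w‖ := by
      intro t
      refine norm_intOp_mulOp_le w _ t fun s hs => ?_
      rw [ContinuousMap.mul_apply, norm_mul]
      have : ‖expC k s‖ = Real.exp (k * s) := by
        simp [expC, Complex.norm_exp]
      rw [this]
      gcongr
      exact φ.norm_coe_le_norm s
    have h2 : ‖volterra w (expC k * φ) x‖ ≤ Real.exp (k * x) * (‖w‖ / k * ‖φ‖) := by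
      change ‖intOp (mulOp one2 _) x‖ ≤ _
      rw [intOp_apply, integral_congr_edge (coeFn_mulOp_one2 _) x.2]
      calc _ ≤ ∫ t in (0 : ℝ)..x, Real.exp (k * t) * (‖φ‖ * ‖w‖) := by
            refine intervalIntegral.norm_integral_le_of_norm_le x.2.1
              (Eventually.of_forall fun t ht => ?_) (Continuous.intervalIntegrable (by fun_prop) _ _)
            have ht' : t ∈ Icc (0 : ℝ) 1 := ⟨ht.1.le, ht.2.trans x.2.2⟩
            rw [extend_of_mem _ ht', ← mul_assoc]
            exact h1 ⟨t, ht'⟩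
        _ = k⁻¹ * (Real.exp (k * x) - 1) * (‖φ‖ * ‖w‖) := by
            rw [intervalIntegral.integral_mul_const, intervalIntegral.integral_comp_mul_left
              (fun y => Real.exp y) hk0.ne']
            simp
        _ ≤ k⁻¹ * Real.exp (k * x) * (‖φ‖ * ‖w‖) := by
            gcongr
            linarith
        _ = _ := by field_simp
    have h3 : ‖expC (-k) x‖ = Real.exp (-(k * x)) := by
      simp [expC, Complex.norm_exp]
    change ‖expC (-k) x * volterra w (expC k * φ) x‖ ≤ _
    rw [norm_mul, h3]
    calc _ ≤ Real.exp (-(k * x)) * (Real.exp (k * x) * (‖w‖ / k * ‖φ‖)) := by gcongr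
      _ = _ := by rw [← mul_assoc, ← Real.exp_add]; simp
  have hu := isUnit_one_sub_of_norm_lt_one (R := C01 →L[ℂ] C01) hn
  have hEu : IsUnit (E k) := ⟨⟨E k, E (-k), hE, hE'⟩, rfl⟩
  have hEu' : IsUnit (E (-k)) := ⟨⟨E (-k), E k, hE', hE⟩, rfl⟩
  have : 1 - volterra w = E k * (1 - E (-k) * volterra w * E k) * E (-k) :=
    one_sub_eq_conj (R := C01 →L[ℂ] C01) hE _
  rw [this]
  exact (hEu.mul hu).mul hEu'

/-- The inverse of `1 - volterra w`. -/
def solve (w : L2E) : C01 →L[ℂ] C01 := Ring.inverse (1 - volterra w)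

theorem solve_eq_iff (w : L2E) (φ ψ : C01) : φ = solve w ψ ↔ φ = ψ + volterra w φ := by
  have h1 : (1 - volterra w) * solve w = 1 := Ring.mul_inverse_cancel _ (isUnit_one_sub_volterra w)
  have h2 : solve w * (1 - volterra w) = 1 := Ring.inverse_mul_cancel _ (isUnit_one_sub_volterra w)
  constructor
  · rintro rfl
    have := congrArg (fun T : C01 →L[ℂ] C01 => T ψ) h1
    simp only [mul_apply_eq_comp, sub_apply,
      one_apply_eq_self] at this
    rw [← sub_eq_iff_eq_add]
    exact this
  · intro h
    have := congrArg (fun T : C01 →L[ℂ] C01 => T φ) h2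
    simp only [mul_apply_eq_comp, sub_apply,
      one_apply_eq_self] at this
    rw [← sub_eq_iff_eq_add] at h
    rw [← h, this]

/-! ### The inhomogeneous initial value problem -/

/-- The solution of `φ'' = w φ - v` with `φ 0 = α`, `φ' 0 = β`. -/
def sol (w v : L2E) (α β : ℂ) : C01 :=
  solve w (α • 1 + β • intOp one2 - intOp (mulOp one2 (intOp v)))

/-- The derivative of `sol`. -/
def dsol (w v : L2E) (α β : ℂ) : C01 := β • 1 + intOp (mulOp w (sol w v α β) - v)

theorem mulOp_one2_one : mulOp one2 1 = one2 := by
  refine Lp.ext ?_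
  filter_upwards [coeFn_mulOp_one2 1, coeFn_one2] with x h1 h2
  rw [h1, h2]
  rfl

theorem eq_sol_iff (w v : L2E) (α β : ℂ) (φ : C01) :
    φ = sol w v α β ↔
      φ = α • 1 + intOp (mulOp one2 (β • 1 + intOp (mulOp w φ - v))) := by
  rw [sol, solve_eq_iff]
  have : α • (1 : C01) + β • intOp one2 - intOp (mulOp one2 (intOp v)) + volterra w φ =
      α • 1 + intOp (mulOp one2 (β • 1 + intOp (mulOp w φ - v))) := by
    simp only [map_add, map_sub, map_smul, mulOp_one2_one, volterra,
      ContinuousLinearMap.comp_apply]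
    abel
  rw [this]

theorem sol_eq (w v : L2E) (α β : ℂ) :
    sol w v α β = α • 1 + intOp (mulOp one2 (dsol w v α β)) :=
  (eq_sol_iff w v α β _).1 rfl

theorem sol_zero (w v : L2E) (α β : ℂ) : sol w v α β ⟨0, by simp⟩ = α := by
  rw [sol_eq, ContinuousMap.add_apply, intOp_apply]
  simp

theorem dsol_zero (w v : L2E) (α β : ℂ) : dsol w v α β ⟨0, by simp⟩ = β := by
  rw [dsol, ContinuousMap.add_apply, intOp_apply]
  simp

theorem IsH2.continuousOn_deriv {φ φ' φ'' : ℝ → ℂ} (h : IsH2 φ φ' φ'') :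
    ContinuousOn φ' (Icc 0 1) := by
  have hi : Integrable φ'' edgeMeasure := h.memLp.integrable (by norm_num)
  have hi' : IntegrableOn φ'' (uIcc 0 1) volume := by rw [uIcc_of_le zero_le_one]; exact hi
  have := intervalIntegral.continuousOn_primitive_interval hi'
  rw [uIcc_of_le zero_le_one] at this
  exact (continuousOn_const.add this).congr h.second

theorem IsH2.continuousOn {φ φ' φ'' : ℝ → ℂ} (h : IsH2 φ φ' φ'') :
    ContinuousOn φ (Icc 0 1) := by
  have hi' : IntegrableOn φ' (uIcc 0 1) volume := by
    rw [uIcc_of_le zero_le_one]; exact h.continuousOn_deriv.integrableOn_Icc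
  have := intervalIntegral.continuousOn_primitive_interval hi'
  rw [uIcc_of_le zero_le_one] at this
  exact (continuousOn_const.add this).congr h.first

theorem isH2_extend_sol (w v : L2E) (α β : ℂ) {φ'' : ℝ → ℂ}
    (h : φ'' =ᵐ[edgeMeasure] fun x => w x * extend (sol w v α β) x - v x) :
    IsH2 (extend (sol w v α β)) (extend (dsol w v α β)) φ'' := by
  have h0 : (0 : ℝ) ∈ Icc (0 : ℝ) 1 := ⟨le_rfl, zero_le_one⟩
  refine ⟨?_, fun x hx => ?_, fun x hx => ?_⟩
  · exact ((memLp_mul_extend w _).sub (Lp.memLp v)).ae_eq h.symm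
  · rw [extend_of_mem _ hx, extend_of_mem _ h0, sol_zero]
    conv_lhs => rw [sol_eq]
    rw [ContinuousMap.add_apply, intOp_apply, integral_congr_edge (coeFn_mulOp_one2 _) hx]
    simp
  · rw [extend_of_mem _ hx, extend_of_mem _ h0, dsol_zero]
    conv_lhs => rw [dsol]
    rw [ContinuousMap.add_apply, intOp_apply]
    have : (mulOp w (sol w v α β) - v : L2E) =ᵐ[edgeMeasure] φ'' := by
      filter_upwards [Lp.coeFn_sub (mulOp w (sol w v α β)) v, coeFn_mulOp w (sol w v α β), h]
        with t h1 h2 h3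
      rw [h1, h3, Pi.sub_apply, h2]
    rw [integral_congr_edge this hx]
    simp

/-- Integrating twice turns the equation into the Volterra fixed point equation, whose solution is
unique. This is what makes every question about `H²` solutions a question about their Cauchy data at
`0`. -/
theorem IsH2.eq_sol {φ φ' φ'' : ℝ → ℂ} (h : IsH2 φ φ' φ'') (w v : L2E)
    (hode : φ'' =ᵐ[edgeMeasure] fun x => w x * φ x - v x) :
    ∀ x (hx : x ∈ Icc (0 : ℝ) 1),
      φ x = sol w v (φ 0) (φ' 0) ⟨x, hx⟩ ∧ φ' x = dsol w v (φ 0) (φ' 0) ⟨x, hx⟩ := by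
  let Φ : C01 := restrictC h.continuousOn
  let Φ' : C01 := restrictC h.continuousOn_deriv
  have hmem : ∀ᵐ x ∂edgeMeasure, x ∈ Icc (0 : ℝ) 1 := ae_restrict_mem measurableSet_Icc
  have h1 : Φ' = φ' 0 • 1 + intOp (mulOp w Φ - v) := by
    ext x
    have : (mulOp w Φ - v : L2E) =ᵐ[edgeMeasure] φ'' := by
      filter_upwards [Lp.coeFn_sub (mulOp w Φ) v, coeFn_mulOp w Φ, hode, hmem] with t h1 h2 h3 h4
      rw [h1, h3, Pi.sub_apply, h2, extend_of_mem _ h4]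
      rfl
    rw [ContinuousMap.add_apply, intOp_apply, integral_congr_edge this x.2]
    simpa [Φ', restrictC_apply] using h.second x x.2
  have h2 : Φ = φ 0 • 1 + intOp (mulOp one2 Φ') := by
    ext x
    have : mulOp one2 Φ' =ᵐ[edgeMeasure] φ' := by
      filter_upwards [coeFn_mulOp_one2 Φ', hmem] with t h1 h4
      rw [h1, extend_of_mem _ h4]
      rfl
    rw [ContinuousMap.add_apply, intOp_apply, integral_congr_edge this x.2]
    simpa [Φ, restrictC_apply] using h.first x x.2
  have h3 : Φ = sol w v (φ 0) (φ' 0) := by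
    rw [eq_sol_iff, ← h1]
    exact h2
  intro x hx
  refine ⟨?_, ?_⟩
  · rw [← h3]; rfl
  · rw [dsol, ← h3, ← h1]; rfl

/-! ### Integration by parts -/

/-- Increments of the primitive of `f` are dominated by those of the primitive of the real function
`‖f‖`, so the same `δ` works. -/
theorem absolutelyContinuousOnInterval_integral {f : ℝ → ℂ} {a b : ℝ}
    (h : IntervalIntegrable f volume a b) :
    AbsolutelyContinuousOnInterval (fun x => ∫ t in a..x, f t) a b := by
  have hn := h.norm.absolutelyContinuousOnInterval_intervalIntegral (c := a) left_mem_uIcc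
  rw [absolutelyContinuousOnInterval_iff] at hn ⊢
  intro ε hε
  obtain ⟨δ, hδ, H⟩ := hn ε hε
  refine ⟨δ, hδ, fun E hE hl => lt_of_le_of_lt (Finset.sum_le_sum fun i hi => ?_) (H E hE hl)⟩
  have hmem := hE.1 i hi
  have hi : ∀ y ∈ uIcc a b, IntervalIntegrable f volume a y := fun y hy =>
    h.mono_set (uIcc_subset_uIcc left_mem_uIcc hy)
  rw [dist_eq_norm, Real.dist_eq, intervalIntegral.integral_interval_sub_left (hi _ hmem.1)
    (hi _ hmem.2), intervalIntegral.integral_interval_sub_left (hi _ hmem.1).norm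
    (hi _ hmem.2).norm]
  exact intervalIntegral.norm_integral_le_abs_integral_norm

/-- The product minus the primitive of its formal derivative is absolutely continuous with
derivative zero almost everywhere, hence constant. -/
theorem integral_deriv_mul_add_mul_deriv {f f' g g' : ℝ → ℂ}
    (hf' : IntervalIntegrable f' volume 0 1) (hg' : IntervalIntegrable g' volume 0 1)
    (hf : ∀ x ∈ Icc (0 : ℝ) 1, f x = f 0 + ∫ t in (0 : ℝ)..x, f' t)
    (hg : ∀ x ∈ Icc (0 : ℝ) 1, g x = g 0 + ∫ t in (0 : ℝ)..x, g' t) :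
    ∫ t in (0 : ℝ)..1, (f' t * g t + f t * g' t) = f 1 * g 1 - f 0 * g 0 := by
  set F : ℝ → ℂ := fun x => f 0 + ∫ t in (0 : ℝ)..x, f' t with hF
  set G : ℝ → ℂ := fun x => g 0 + ∫ t in (0 : ℝ)..x, g' t with hG
  have hconst : ∀ c : ℂ, AbsolutelyContinuousOnInterval (fun _ : ℝ => c) 0 1 := fun c =>
    ((LipschitzWith.const c).lipschitzOnWith).absolutelyContinuousOnInterval
  have hFac : AbsolutelyContinuousOnInterval F 0 1 :=
    (hconst _).add (absolutelyContinuousOnInterval_integral hf')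
  have hGac : AbsolutelyContinuousOnInterval G 0 1 :=
    (hconst _).add (absolutelyContinuousOnInterval_integral hg')
  have hint : IntervalIntegrable (fun t => f' t * G t + F t * g' t) volume 0 1 :=
    (hf'.mul_continuousOn hGac.continuousOn).add (hg'.continuousOn_mul hFac.continuousOn)
  have hD : ∀ᵐ x, x ∈ uIcc (0 : ℝ) 1 →
      HasDerivAt (fun x => (F • G) x - ∫ t in (0 : ℝ)..x, (f' t * G t + F t * g' t)) 0 x := by
    filter_upwards [hf'.ae_hasDerivAt_integral, hg'.ae_hasDerivAt_integral,
      hint.ae_hasDerivAt_integral] with x h1 h2 h3 hx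
    have := (((h1 hx 0 left_mem_uIcc).const_add (f 0)).mul
      ((h2 hx 0 left_mem_uIcc).const_add (g 0))).sub (h3 hx 0 left_mem_uIcc)
    convert! this using 1
    simp [F, G]
  obtain ⟨C, hC⟩ := ((hFac.smul hGac).sub
    (absolutelyContinuousOnInterval_integral hint)).const_of_ae_hasDerivAt_zero hD
  have h0 := hC 0 left_mem_uIcc
  have h1 := hC 1 right_mem_uIcc
  have e0 : ∀ x ∈ Icc (0 : ℝ) 1, F x = f x := fun x hx => (hf x hx).symm
  have e1 : ∀ x ∈ Icc (0 : ℝ) 1, G x = g x := fun x hx => (hg x hx).symm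
  have hcongr : ∫ t in (0 : ℝ)..1, (f' t * g t + f t * g' t) =
      ∫ t in (0 : ℝ)..1, (f' t * G t + F t * g' t) := by
    refine intervalIntegral.integral_congr fun t ht => ?_
    rw [uIcc_of_le zero_le_one] at ht
    simp only [e0 t ht, e1 t ht]
  rw [hcongr]
  simp only [Pi.sub_apply, Pi.mul_apply, smul_eq_mul, intervalIntegral.integral_same,
    sub_zero] at h0 h1
  rw [e0 0 (by simp), e1 0 (by simp)] at h0
  rw [e0 1 (by simp), e1 1 (by simp)] at h1
  rw [h0, ← h1]
  ring

theorem IsH2.intervalIntegrable_deriv {φ φ' φ'' : ℝ → ℂ} (h : IsH2 φ φ' φ'') :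
    IntervalIntegrable φ' volume 0 1 :=
  ContinuousOn.intervalIntegrable (by rw [uIcc_of_le zero_le_one]; exact h.continuousOn_deriv)

theorem IsH2.intervalIntegrable_second {φ φ' φ'' : ℝ → ℂ} (h : IsH2 φ φ' φ'') :
    IntervalIntegrable φ'' volume 0 1 :=
  intervalIntegrable_of_integrable (h.memLp.integrable (by norm_num)) (by simp) (by simp)

/-- Lagrange's identity. -/
theorem IsH2.lagrange {f f' f'' g g' g'' : ℝ → ℂ} (hf : IsH2 f f' f'') (hg : IsH2 g g' g'') :
    ∫ t in (0 : ℝ)..1, (f t * g'' t - f'' t * g t) =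
      (f 1 * g' 1 - f' 1 * g 1) - (f 0 * g' 0 - f' 0 * g 0) := by
  have h1 := integral_deriv_mul_add_mul_deriv hf.intervalIntegrable_deriv
    hg.intervalIntegrable_second hf.first hg.second
  have h2 := integral_deriv_mul_add_mul_deriv hf.intervalIntegrable_second
    hg.intervalIntegrable_deriv hf.second hg.first
  have c1 := hf.continuousOn
  have c2 := hg.continuousOn
  have c3 := hf.continuousOn_deriv
  have c4 := hg.continuousOn_deriv
  rw [← uIcc_of_le zero_le_one] at c1 c2 c3 c4
  have := intervalIntegral.integral_sub
    ((hf.intervalIntegrable_deriv.mul_continuousOn c4).add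
      (hg.intervalIntegrable_second.continuousOn_mul c1))
    ((hf.intervalIntegrable_second.mul_continuousOn c2).add
      (hg.intervalIntegrable_deriv.continuousOn_mul c3))
  rw [h1, h2] at this
  rw [show (f 1 * g' 1 - f' 1 * g 1) - (f 0 * g' 0 - f' 0 * g 0) =
    f 1 * g' 1 - f 0 * g' 0 - (f' 1 * g 1 - f' 0 * g 0) by ring, ← this]
  refine intervalIntegral.integral_congr fun t _ => ?_
  ring

/-! ### Symmetries of the Sobolev space -/

theorem IsH2.conj {φ φ' φ'' : ℝ → ℂ} (h : IsH2 φ φ' φ'') :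
    IsH2 (fun x => star (φ x)) (fun x => star (φ' x)) (fun x => star (φ'' x)) := by
  have hint : ∀ (f : ℝ → ℂ) (x : ℝ), ∫ t in (0 : ℝ)..x, star (f t) =
      star (∫ t in (0 : ℝ)..x, f t) := fun f x => by
    simp only [intervalIntegral, star_sub]
    congr 1 <;> exact integral_conj
  refine ⟨h.memLp.star, fun x hx => ?_, fun x hx => ?_⟩
  · rw [hint, h.first x hx, star_add]
  · rw [hint, h.second x hx, star_add]

theorem measurePreserving_reflect :
    MeasurePreserving (fun x : ℝ => 1 - x) edgeMeasure edgeMeasure := by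
  have h := (Measure.measurePreserving_sub_left (volume : Measure ℝ) 1).restrict_preimage
    (measurableSet_Icc (a := (0 : ℝ)) (b := 1))
  have hp : (fun x : ℝ => 1 - x) ⁻¹' Icc (0 : ℝ) 1 = Icc 0 1 := by
    rw [preimage_const_sub_Icc]; simp
  rwa [hp] at h

theorem IsH2.reflect {φ φ' φ'' : ℝ → ℂ} (h : IsH2 φ φ' φ'') :
    IsH2 (fun x => φ (1 - x)) (fun x => -φ' (1 - x)) (fun x => φ'' (1 - x)) := by
  have hkey : ∀ {f f' : ℝ → ℂ}, IntervalIntegrable f' volume 0 1 →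
      (∀ x ∈ Icc (0 : ℝ) 1, f x = f 0 + ∫ t in (0 : ℝ)..x, f' t) → ∀ x ∈ Icc (0 : ℝ) 1,
      f (1 - x) = f (1 - 0) - ∫ t in (0 : ℝ)..x, f' (1 - t) := by
    intro f f' hi hf x hx
    have hx' : 1 - x ∈ Icc (0 : ℝ) 1 := ⟨by linarith [hx.2], by linarith [hx.1]⟩
    rw [intervalIntegral.integral_comp_sub_left, hf (1 - x) hx', hf (1 - 0) (by simp), sub_zero,
      ← intervalIntegral.integral_add_adjacent_intervals (b := 1 - x)
        (hi.mono_set (uIcc_subset_uIcc left_mem_uIcc (by rwa [uIcc_of_le zero_le_one])))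
        (hi.mono_set (uIcc_subset_uIcc (by rwa [uIcc_of_le zero_le_one]) right_mem_uIcc))]
    ring
  refine ⟨h.memLp.comp_measurePreserving measurePreserving_reflect, fun x hx => ?_, fun x hx => ?_⟩
  · rw [intervalIntegral.integral_neg, ← sub_eq_add_neg]
    exact hkey h.intervalIntegrable_deriv h.first x hx
  · rw [hkey h.intervalIntegrable_second h.second x hx]
    ring

/-! ### Fundamental solutions of the Hill equation -/

theorem memLp_ofReal {q : ℝ → ℝ} (hq : MemLp q 2 edgeMeasure) :
    MemLp (fun x => (q x : ℂ)) 2 edgeMeasure := hq.ofReal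

/-- The coefficient `q - z` of the Hill equation `φ'' = (q - z) φ`. -/
def pot {q : ℝ → ℝ} (hq : MemLp q 2 edgeMeasure) (z : ℂ) : L2E :=
  (memLp_ofReal hq).toLp - z • one2

theorem coeFn_pot {q : ℝ → ℝ} (hq : MemLp q 2 edgeMeasure) (z : ℂ) :
    pot hq z =ᵐ[edgeMeasure] fun x => q x - z := by
  filter_upwards [Lp.coeFn_sub (memLp_ofReal hq).toLp (z • one2), Lp.coeFn_smul z one2,
    coeFn_one2, (memLp_ofReal hq).coeFn_toLp] with x h1 h2 h3 h4
  rw [pot, h1, Pi.sub_apply, h2, Pi.smul_apply, h3, h4, smul_eq_mul, mul_one]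

/-- The right endpoint of `[0,1]`. -/
abbrev right : Icc (0 : ℝ) 1 := ⟨1, by simp⟩

theorem extend_one (φ : C01) : extend φ 1 = φ right := extend_of_mem φ (by simp)

theorem extend_sol_zero (w v : L2E) (α β : ℂ) : extend (sol w v α β) 0 = α :=
  (extend_of_mem _ (by simp)).trans (sol_zero w v α β)

theorem extend_dsol_zero (w v : L2E) (α β : ℂ) : extend (dsol w v α β) 0 = β :=
  (extend_of_mem _ (by simp)).trans (dsol_zero w v α β)

theorem sol_linear (w v : L2E) (α β : ℂ) :
    sol w v α β = sol w v 0 0 + α • sol w 0 1 0 + β • sol w 0 0 1 := by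
  simp only [sol, ← map_smul, ← map_add]
  congr 1
  ext x
  simp
  ring

theorem dsol_linear (w v : L2E) (α β : ℂ) :
    dsol w v α β = dsol w v 0 0 + α • dsol w 0 1 0 + β • dsol w 0 0 1 := by
  simp only [dsol]
  rw [sol_linear w v α β]
  simp only [map_add, map_sub, map_smul]
  ext x
  simp
  ring

theorem sol_homogeneous_zero (w : L2E) : sol w 0 0 0 = 0 := by
  have : (0 : ℂ) • (1 : C01) + (0 : ℂ) • intOp one2 - intOp (mulOp one2 (intOp 0)) = 0 := by
    ext x
    simp
  rw [sol, this, map_zero]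

theorem dsol_homogeneous_zero (w : L2E) : dsol w 0 0 0 = 0 := by
  ext x
  simp [dsol, sol_homogeneous_zero]

section Hill

variable {q : ℝ → ℝ} (hq : MemLp q 2 edgeMeasure) (z : ℂ)

/-- The solution with `φ 0 = 1`, `φ' 0 = 0`. -/
def cosSol : C01 := sol (pot hq z) 0 1 0

/-- The derivative of `cosSol`. -/
def dcosSol : C01 := dsol (pot hq z) 0 1 0

/-- The solution with `φ 0 = 0`, `φ' 0 = 1`. -/
def sinSol : C01 := sol (pot hq z) 0 0 1

/-- The derivative of `sinSol`. -/
def dsinSol : C01 := dsol (pot hq z) 0 0 1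

theorem isH2_hill (α β : ℂ) : IsH2 (extend (sol (pot hq z) 0 α β)) (extend (dsol (pot hq z) 0 α β))
    (fun x => (q x - z) * extend (sol (pot hq z) 0 α β) x) := by
  refine isH2_extend_sol _ _ _ _ ?_
  filter_upwards [coeFn_pot hq z, Lp.coeFn_zero ℂ 2 edgeMeasure] with x h1 h2
  rw [h1, h2, Pi.zero_apply, sub_zero]

theorem isHillSolution_sol (α β : ℂ) :
    IsHillSolution q z (extend (sol (pot hq z) 0 α β)) (extend (dsol (pot hq z) 0 α β)) :=
  ⟨_, isH2_hill hq z α β, Eventually.of_forall fun x => by ring⟩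

theorem IsHillSolution.eq_sol {φ φ' : ℝ → ℂ} (h : IsHillSolution q z φ φ') (x : ℝ)
    (hx : x ∈ Icc (0 : ℝ) 1) :
    φ x = φ 0 * cosSol hq z ⟨x, hx⟩ + φ' 0 * sinSol hq z ⟨x, hx⟩ ∧
      φ' x = φ 0 * dcosSol hq z ⟨x, hx⟩ + φ' 0 * dsinSol hq z ⟨x, hx⟩ := by
  obtain ⟨φ'', h2, hode⟩ := h
  have : φ'' =ᵐ[edgeMeasure] fun x => pot hq z x * φ x - (0 : L2E) x := by
    filter_upwards [coeFn_pot hq z, Lp.coeFn_zero ℂ 2 edgeMeasure, hode] with x h1 h2 h3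
    rw [h1, h2, Pi.zero_apply]
    linear_combination -h3
  have := h2.eq_sol _ _ this x hx
  rw [sol_linear, dsol_linear, sol_homogeneous_zero, dsol_homogeneous_zero] at this
  simpa [cosSol, sinSol, dcosSol, dsinSol] using this

/-- Lagrange's identity for two solutions with the same `z`: the integrand vanishes, so the
Wronskian keeps its value at `0`. -/
theorem wronskian :
    cosSol hq z right * dsinSol hq z right - dcosSol hq z right * sinSol hq z right = 1 := by
  have h := (isH2_hill hq z 1 0).lagrange (isH2_hill hq z 0 1)
  simp only [extend_one, extend_sol_zero, extend_dsol_zero] at h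
  have h0 : ∀ t, extend (sol (pot hq z) 0 1 0) t * ((q t - z) * extend (sol (pot hq z) 0 0 1) t) -
      (q t - z) * extend (sol (pot hq z) 0 1 0) t * extend (sol (pot hq z) 0 0 1) t = 0 :=
    fun t => by ring
  simp only [h0, intervalIntegral.integral_zero] at h
  simp only [cosSol, sinSol, dcosSol, dsinSol]
  linear_combination -h

/-- The two fundamental solutions determine the columns. Existence and uniqueness together show that
the choice in `monodromyMatrix` returns this matrix. -/
theorem isMonodromyMatrix_iff (M : Matrix (Fin 2) (Fin 2) ℂ) :
    IsMonodromyMatrix q z M ↔ M = !![cosSol hq z right, sinSol hq z right;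
      dcosSol hq z right, dsinSol hq z right] := by
  constructor
  · intro h
    have h1 := h _ _ (isHillSolution_sol hq z 1 0)
    have h2 := h _ _ (isHillSolution_sol hq z 0 1)
    simp only [extend_one, extend_sol_zero, extend_dsol_zero] at h1 h2
    ext i j
    fin_cases i <;> fin_cases j
    · simpa [cosSol] using (congrFun h1 0).symm
    · simpa [sinSol] using (congrFun h2 0).symm
    · simpa [dcosSol] using (congrFun h1 1).symm
    · simpa [dsinSol] using (congrFun h2 1).symm
  · rintro rfl φ φ' h
    have := h.eq_sol hq z 1 (by simp)
    rw [this.1, this.2]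
    ext i
    fin_cases i <;> simp [Matrix.mulVec, dotProduct] <;> ring

theorem discriminant_eq : discriminant q z = cosSol hq z right + dsinSol hq z right := by
  have h : IsMonodromyMatrix q z (monodromyMatrix q z) :=
    Classical.epsilon_spec ⟨_, (isMonodromyMatrix_iff hq z _).2 rfl⟩
  rw [discriminant, (isMonodromyMatrix_iff hq z _).1 h, Matrix.trace_fin_two]
  simp

theorem IsHillSolution.reflect (heven : ∀ᵐ x ∂edgeMeasure, q (1 - x) = q x) {φ φ' : ℝ → ℂ}
    (h : IsHillSolution q z φ φ') :
    IsHillSolution q z (fun x => φ (1 - x)) (fun x => -φ' (1 - x)) := by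
  obtain ⟨φ'', h2, hode⟩ := h
  refine ⟨_, h2.reflect, ?_⟩
  filter_upwards [measurePreserving_reflect.quasiMeasurePreserving.ae hode, heven] with x h1 h2
  rw [← h2]
  exact h1

theorem IsHillSolution.conj {φ φ' : ℝ → ℂ} (h : IsHillSolution q z φ φ') :
    IsHillSolution q (star z) (fun x => star (φ x)) (fun x => star (φ' x)) := by
  obtain ⟨φ'', h2, hode⟩ := h
  refine ⟨_, h2.conj, ?_⟩
  filter_upwards [hode] with x h1
  have := congrArg star h1
  simpa [mul_comm] using this

variable {z}

/-- For even `q` the reflected solution `s(1-x)` is again a solution, equal to `s(1) c(x) - s'(1)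
s(x)`. At `x = 1` this gives `0 = s(1) (c(1) - s'(1))`. -/
theorem cosSol_eq_dsinSol (heven : ∀ᵐ x ∂edgeMeasure, q (1 - x) = q x)
    (hs : sinSol hq z right ≠ 0) : cosSol hq z right = dsinSol hq z right := by
  have h := (((isHillSolution_sol hq z 0 1).reflect z heven).eq_sol hq z 1 (by simp)).1
  simp only [sub_self, sub_zero, extend_sol_zero, extend_one] at h
  change 0 = sinSol hq z right * cosSol hq z right + -dsinSol hq z right * sinSol hq z right at h
  exact mul_left_cancel₀ hs (by linear_combination -h)

/-- If `s(1) = 0`, differentiating the reflection formula at `1` gives `s'(1)² = 1`, while the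
Wronskian identity and `c(1) = -s'(1)` give `s'(1)² = -1`. -/
theorem sinSol_ne_zero (heven : ∀ᵐ x ∂edgeMeasure, q (1 - x) = q x)
    (hD : discriminant q z = 0) : sinSol hq z right ≠ 0 := by
  intro hs
  have h := (((isHillSolution_sol hq z 0 1).reflect z heven).eq_sol hq z 1 (by simp)).2
  simp only [sub_self, sub_zero, extend_dsol_zero, extend_one] at h
  change -1 = sinSol hq z right * dcosSol hq z right + -dsinSol hq z right * dsinSol hq z right at h
  have hw := wronskian hq z
  rw [discriminant_eq hq] at hD
  rw [hs] at h hw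
  have : (2 : ℂ) = 0 := by linear_combination -h - hw + dsinSol hq z right * hD
  norm_num at this

theorem cosSol_eq_zero (heven : ∀ᵐ x ∂edgeMeasure, q (1 - x) = q x)
    (hD : discriminant q z = 0) : cosSol hq z right = 0 := by
  have h1 := cosSol_eq_dsinSol hq heven (sinSol_ne_zero hq heven hD)
  rw [discriminant_eq hq, ← h1] at hD
  linear_combination hD / 2

theorem star_cosSol (l : ℝ) (x : Icc (0 : ℝ) 1) : star (cosSol hq l x) = cosSol hq l x := by
  have h := ((isHillSolution_sol hq l 1 0).conj (l : ℂ))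
  rw [show star (l : ℂ) = l from Complex.conj_ofReal l] at h
  have := (h.eq_sol hq l x x.2).1
  simp only [extend_sol_zero, extend_dsol_zero, extend_of_mem _ x.2] at this
  simpa [cosSol] using this

/-! ### Dependence on the spectral parameter -/

theorem mulOp_sub_smul (w₁ w₂ : L2E) (z : ℂ) : mulOp (w₁ - z • w₂) = mulOp w₁ - z • mulOp w₂ := by
  ext1 φ
  refine Lp.ext ?_
  have e : (mulOp w₁ - z • mulOp w₂) φ = mulOp w₁ φ - z • mulOp w₂ φ := rfl
  rw [e]
  filter_upwards [coeFn_mulOp (w₁ - z • w₂) φ, coeFn_mulOp w₁ φ, coeFn_mulOp w₂ φ,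
    Lp.coeFn_sub w₁ (z • w₂), Lp.coeFn_smul z w₂, Lp.coeFn_sub (mulOp w₁ φ) (z • mulOp w₂ φ),
    Lp.coeFn_smul z (mulOp w₂ φ)] with x h1 h2 h3 h4 h5 h6 h7
  rw [h1, h4, h6, Pi.sub_apply, Pi.sub_apply, h5, h7, Pi.smul_apply, Pi.smul_apply, h2, h3,
    smul_eq_mul, smul_eq_mul]
  ring

theorem volterra_pot : volterra (pot hq z) =
    volterra (memLp_ofReal hq).toLp - z • volterra one2 := by
  simp only [volterra, pot, mulOp_sub_smul]
  ext1 φ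
  simp

/-- The Volterra operator is affine in the spectral parameter and inversion is analytic on units;
this is the source of analyticity of the fundamental solutions in `z`. -/
theorem contDiffAt_inverse_pencil {E : Type*} [NormedAddCommGroup E] [NormedSpace ℂ E]
    [CompleteSpace E] (A B : E →L[ℂ] E) (e : E) (z : ℂ) (h : IsUnit (1 - (A - z • B))) :
    ContDiffAt ℂ ω (fun z => (Ring.inverse (1 - (A - z • B)) : E →L[ℂ] E) e) z := by
  have h1 : ContDiffAt ℂ ω (fun z => 1 - (A - z • B)) z := by fun_prop
  have h2 : ContDiffAt ℂ ω (Ring.inverse : (E →L[ℂ] E) → E →L[ℂ] E) (1 - (A - z • B)) := by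
    obtain ⟨u, hu⟩ := h
    rw [← hu]
    exact contDiffAt_ringInverse ℂ u
  exact (h2.comp z h1).clm_apply contDiffAt_const

theorem contDiff_sol_pot (α β : ℂ) : ContDiff ℂ ω fun z => sol (pot hq z) 0 α β := by
  rw [contDiff_iff_contDiffAt]
  intro z
  have h := isUnit_one_sub_volterra (pot hq z)
  simp only [sol, solve]
  simp only [volterra_pot] at h ⊢
  exact contDiffAt_inverse_pencil (E := C01) _ _ _ z h

theorem contDiff_eval_sol_pot (α β : ℂ) (x : Icc (0 : ℝ) 1) :
    ContDiff ℂ ω fun z => sol (pot hq z) 0 α β x :=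
  (ContinuousMap.evalCLM ℂ x : C01 →L[ℂ] ℂ).contDiff.comp (contDiff_sol_pot hq α β)

/-- The real-valued function `λ ↦ cosSol (λ) 1`, half the discriminant for even potentials. -/
def eta (l : ℝ) : ℝ := (cosSol hq l right).re

theorem ofReal_eta (l : ℝ) : (eta hq l : ℂ) = cosSol hq l right :=
  Complex.conj_eq_iff_re.1 (star_cosSol hq l right)

theorem contDiff_eta : ContDiff ℝ ω (eta hq) :=
  Complex.reCLM.contDiff.comp
    (((contDiff_eval_sol_pot hq 1 0 right).restrict_scalars ℝ).comp Complex.ofRealCLM.contDiff)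

/-- Lagrange's identity for `c_z` and the conjugate of `c_l`. Both have slope zero at `0`, and
`c_l(1) = 0`, so a single boundary term survives. -/
theorem cosSol_mul_star (l : ℝ) (hl : cosSol hq l right = 0) (z : ℂ) :
    cosSol hq z right * star (dcosSol hq l right) =
      (z - l) * ∫ t in (0 : ℝ)..1, extend (cosSol hq z) t * star (extend (cosSol hq l) t) := by
  have h := (isH2_hill hq z 1 0).lagrange (isH2_hill hq l 1 0).conj
  simp only [extend_one, extend_sol_zero, extend_dsol_zero] at h
  rw [← intervalIntegral.integral_const_mul]
  change _ = cosSol hq z right * star (dcosSol hq l right) -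
    dcosSol hq z right * star (cosSol hq l right) - _ at h
  rw [hl] at h
  have e : ∀ a : ℂ, a - dcosSol hq z right * star 0 - (1 * star 0 - 0 * star 1) = a :=
    fun a => by simp
  rw [e] at h
  rw [← h]
  refine intervalIntegral.integral_congr fun t _ => ?_
  simp only [cosSol, star_mul', star_sub, Complex.star_def, Complex.conj_ofReal]
  ring

/-- Differentiating `cosSol_mul_star` at `z = l` gives `η'(l) · conj c_l'(1) = ∫ |c_l|²`, which is
positive because `c_l(0) = 1`. It expresses the simplicity of the eigenvalue `l` for a Neumann
condition at `0` and a Dirichlet condition at `1`. -/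
theorem eta_deriv_ne_zero (l : ℝ) (hl : eta hq l = 0) {d : ℝ} (hd : HasDerivAt (eta hq) d l) :
    d ≠ 0 := by
  have hc : cosSol hq l right = 0 := by rw [← ofReal_eta, hl, Complex.ofReal_zero]
  -- As an `L²` weight, the conjugate of `c_l` makes the integral a bounded linear functional of
  -- `c_y`, so `G` inherits differentiability in `y`.
  let cl : L2E := (memLp_mul_extend one2 (star (cosSol hq l))).toLp
  have hcl : cl =ᵐ[edgeMeasure] fun t => star (extend (cosSol hq l) t) := by
    filter_upwards [(memLp_mul_extend one2 (star (cosSol hq l))).coeFn_toLp, coeFn_one2] with t h1 h2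
    rw [h1, h2, one_mul]
    rfl
  let G : ℝ → ℂ := fun y => intOp (mulOp cl (cosSol hq (y : ℂ))) right
  have hG : ∀ y : ℝ, (eta hq y : ℂ) * star (dcosSol hq l right) = ((y - l : ℝ) : ℂ) * G y := by
    intro y
    rw [ofReal_eta, cosSol_mul_star hq l hc, Complex.ofReal_sub]
    congr 1
    refine integral_congr_edge ?_ (x := 1) (by simp)
    filter_upwards [coeFn_mulOp cl (cosSol hq (y : ℂ)), hcl] with t h1 h2
    rw [h1, h2, mul_comm]
  have hGd : DifferentiableAt ℝ G l := by
    have h1 : ContDiff ℝ ω fun y : ℝ => cosSol hq (y : ℂ) :=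
      ((contDiff_sol_pot hq 1 0).restrict_scalars ℝ).comp Complex.ofRealCLM.contDiff
    have h2 := ((((ContinuousMap.evalCLM ℂ right) ∘L intOp ∘L mulOp cl).contDiff
      (n := ω)).restrict_scalars ℝ).comp h1
    exact h2.differentiable (by simp) l
  have e1 : HasDerivAt (fun y : ℝ => ((y - l : ℝ) : ℂ) * G y) (G l) l := by
    have := (((hasDerivAt_id l).sub_const l).ofReal_comp).mul hGd.hasDerivAt
    convert! this using 1
    simp
  have e2 : HasDerivAt (fun y : ℝ => (eta hq y : ℂ) * star (dcosSol hq l right))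
      (d * star (dcosSol hq l right)) l := hd.ofReal_comp.mul_const _
  have e3 : (d : ℂ) * star (dcosSol hq l right) = G l := by
    refine e2.unique ?_
    simp only [hG]
    exact e1
  have hpos : G l ≠ 0 := by
    have h1 : G l = ((∫ t in (0 : ℝ)..1, ‖extend (cosSol hq l) t‖ ^ 2 : ℝ) : ℂ) := by
      rw [← intervalIntegral.integral_ofReal]
      refine integral_congr_edge ?_ (x := 1) (by simp)
      filter_upwards [coeFn_mulOp cl (cosSol hq (l : ℂ)), hcl] with t h1 h2
      rw [h1, h2, Complex.star_def, Complex.conj_mul']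
      push_cast
      rfl
    rw [h1, Complex.ofReal_ne_zero]
    refine (intervalIntegral.integral_pos zero_lt_one ?_ (fun _ _ => by positivity)
      ⟨0, by simp, ?_⟩).ne'
    · exact ((continuous_extend _).norm.pow 2).continuousOn
    · rw [cosSol, extend_sol_zero]; simp
  rintro rfl
  apply hpos
  rw [← e3]
  simp

end Hill

/-! ### Reduction of the Bloch conditions to the fundamental domain -/

theorem IsH2.hasDerivWithinAt {φ φ' φ'' : ℝ → ℂ} (h : IsH2 φ φ' φ'') {x : ℝ}
    (hx : x ∈ Icc (0 : ℝ) 1) : HasDerivWithinAt φ (φ' x) (Icc 0 1) x := by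
  set g := extend (restrictC h.continuousOn_deriv) with hg
  have hgc : Continuous g := continuous_extend _
  have hgφ : ∀ t ∈ Icc (0 : ℝ) 1, g t = φ' t := fun t ht => extend_of_mem _ ht
  have h1 : HasDerivAt (fun y => φ 0 + ∫ t in (0 : ℝ)..y, g t) (g x) x :=
    ((hgc.integral_hasStrictDerivAt 0 x).hasDerivAt).const_add _
  rw [hgφ x hx] at h1
  have h2 : ∀ y ∈ Icc (0 : ℝ) 1, φ y = φ 0 + ∫ t in (0 : ℝ)..y, g t := fun y hy => by
    rw [h.first y hy]
    congr 1
    refine intervalIntegral.integral_congr fun t ht => (hgφ t ?_).symm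
    exact uIcc_subset_Icc (by simp) hy ht
  exact h1.hasDerivWithinAt.congr h2 (h2 x hx)

/-- The Floquet condition is imposed on `u` only; this transfers it to the derivatives in the flux
condition at the vertices `b_p`. -/
theorem IsH2.deriv_eq_mul {φ φ' φ'' ψ ψ' ψ'' : ℝ → ℂ} (h : IsH2 φ φ' φ'') (k : IsH2 ψ ψ' ψ'')
    {c : ℂ} (hc : ∀ x ∈ Icc (0 : ℝ) 1, φ x = c * ψ x) {x : ℝ} (hx : x ∈ Icc (0 : ℝ) 1) :
    φ' x = c * ψ' x :=
  (uniqueDiffOn_Icc zero_lt_one x hx).eq_deriv _ (h.hasDerivWithinAt hx)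
    (((k.hasDerivWithinAt hx).const_mul c).congr hc (hc x hx))

theorem IsH2.const_mul {φ φ' φ'' : ℝ → ℂ} (h : IsH2 φ φ' φ'') (c : ℂ) :
    IsH2 (fun x => c * φ x) (fun x => c * φ' x) (fun x => c * φ'' x) := by
  refine ⟨h.memLp.const_mul c, fun x hx => ?_, fun x hx => ?_⟩
  · rw [intervalIntegral.integral_const_mul, h.first x hx, mul_add]
  · rw [intervalIntegral.integral_const_mul, h.second x hx, mul_add]

/-- The Floquet multiplier of the lattice shift `r`. -/
def phase (θ : ℝ × ℝ) (r : ℤ × ℤ) : ℂ := Complex.exp (Complex.I * (r.1 * θ.1 + r.2 * θ.2))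

theorem phase_zero (θ : ℝ × ℝ) : phase θ 0 = 1 := by simp [phase]

theorem phase_add (θ : ℝ × ℝ) (r s : ℤ × ℤ) : phase θ (r + s) = phase θ r * phase θ s := by
  rw [phase, phase, phase, ← Complex.exp_add]
  congr 1
  push_cast [Prod.fst_add, Prod.snd_add]
  ring

theorem phase_mul_neg (θ : ℝ × ℝ) (r : ℤ × ℤ) : phase θ r * phase θ (-r) = 1 := by
  rw [← phase_add, add_neg_cancel, phase_zero]

theorem phase_neg (θ : ℝ × ℝ) (r : ℤ × ℤ) : phase θ (-r) = star (phase θ r) := by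
  rw [phase, phase, Complex.star_def, ← Complex.exp_conj]
  congr 1
  simp
  ring

/-- The structure function `1 + e^{iθ₁} + e^{iθ₂}` of the honeycomb lattice. -/
def structureFn (θ : ℝ × ℝ) : ℂ := ∑ i : Bond, phase θ i.shift

theorem sum_phase_neg (θ : ℝ × ℝ) : ∑ i : Bond, phase θ (-i.shift) = star (structureFn θ) := by
  simp only [structureFn, star_sum, phase_neg]

/-- The vertex conditions on the fundamental domain, in terms of the boundary values `a`, `b` and
boundary derivatives `a'`, `b'` at the two ends of the edges. -/
def VertexConditions (θ : ℝ × ℝ) (A B : ℂ) (a b a' b' : Bond → ℂ) : Prop :=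
  (∀ i, a i = A) ∧ (∀ i, b i = phase θ (-i.shift) * B) ∧ ∑ i, a' i = 0 ∧
    ∑ i, phase θ i.shift * b' i = 0

theorem IsBlochFunction.vertexConditions {θ : ℝ × ℝ} {u u' u'' : Edge → ℝ → ℂ}
    (h : IsBlochFunction θ u u' u'') :
    ∃ A B, VertexConditions θ A B (fun i => u (0, i) 0) (fun i => u (0, i) 1)
      (fun i => u' (0, i) 0) (fun i => u' (0, i) 1) := by
  obtain ⟨A, hA⟩ := h.continuous_a 0
  obtain ⟨B, hB⟩ := h.continuous_b 0
  refine ⟨A, B, hA, fun i => ?_, h.flux_a 0, ?_⟩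
  · have := h.floquet (-i.shift) (0 + i.shift) i 1 (by simp)
    rw [hB i, add_neg_cancel_right] at this
    exact this
  · have hb := h.flux_b 0
    rw [Finset.sum_neg_distrib, neg_eq_zero] at hb
    rw [← hb]
    refine Finset.sum_congr rfl fun i _ => ?_
    exact ((h.isH2 (0 + i.shift, i)).deriv_eq_mul (h.isH2 (0, i)) (h.floquet i.shift 0 i)
      (by simp)).symm

/-- Data on the three edges extend to the whole graph by Floquet multipliers; the conditions at each
vertex are then multiples of those in the fundamental domain. -/
theorem isBlochFunction_of_vertexConditions {θ : ℝ × ℝ} {A B : ℂ} {φ φ' φ'' : Bond → ℝ → ℂ}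
    (h2 : ∀ i, IsH2 (φ i) (φ' i) (φ'' i))
    (h : VertexConditions θ A B (fun i => φ i 0) (fun i => φ i 1) (fun i => φ' i 0)
      (fun i => φ' i 1)) :
    IsBlochFunction θ (fun e x => phase θ e.1 * φ e.2 x) (fun e x => phase θ e.1 * φ' e.2 x)
      (fun e x => phase θ e.1 * φ'' e.2 x) := by
  obtain ⟨ha, hb, hfa, hfb⟩ := h
  refine ⟨fun e => (h2 e.2).const_mul _, fun p => ⟨phase θ p * A, fun i => ?_⟩,
    fun p => ⟨phase θ p * B, fun i => ?_⟩, fun p => ?_, fun p => ?_, fun r p i x _ => ?_⟩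
  · simp only [ha i]
  · simp only [hb i, phase_add]
    linear_combination phase θ p * B * phase_mul_neg θ i.shift
  · simp only [← Finset.mul_sum, hfa, mul_zero]
  · simp only [phase_add, mul_assoc, Finset.sum_neg_distrib]
    rw [← Finset.mul_sum, hfb, mul_zero, neg_zero]
  · simp only [phase_add]
    change _ = phase θ r * _
    ring

theorem eq_of_mulOp_one2_eq {φ ψ : C01} (h : mulOp one2 φ = mulOp one2 ψ) : φ = ψ := by
  have h1 : extend φ =ᵐ[volume.restrict (Icc (0 : ℝ) 1)] extend ψ := by
    filter_upwards [coeFn_mulOp_one2 φ, coeFn_mulOp_one2 ψ] with x h1 h2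
    rw [← h1, ← h2, h]
  have h2 := Measure.eqOn_Icc_of_ae_eq volume zero_ne_one h1 (continuous_extend φ).continuousOn
    (continuous_extend ψ).continuousOn
  ext x
  have := h2 x.2
  rwa [extend_of_mem _ x.2, extend_of_mem _ x.2] at this

/-! ### The resolvent equation and the spectrum of the Bloch Hamiltonian -/

section Spectrum

variable {q : ℝ → ℝ} (hq : MemLp q 2 edgeMeasure) (z : ℂ) (θ : ℝ × ℝ)

/-- Uniqueness for the initial value problem leaves only finitely many unknowns: the two vertex
values and the three slopes at `0`. -/
theorem mem_blochHamiltonian_iff (U V : L2W) :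
    (U, V + z • U) ∈ blochHamiltonian q θ ↔ ∃ (A B : ℂ) (β : Bond → ℂ),
      (∀ i, U i = mulOp one2 (sol (pot hq z) (V i) A (β i))) ∧
      VertexConditions θ A B (fun _ => A) (fun i => sol (pot hq z) (V i) A (β i) right) β
        (fun i => dsol (pot hq z) (V i) A (β i) right) := by
  have hVU : ∀ i, (V + z • U) i =ᵐ[edgeMeasure] fun x => V i x + z * U i x := fun i => by
    have e : (V + z • U) i = V i + z • U i := rfl
    rw [e]
    filter_upwards [Lp.coeFn_add (V i) (z • U i), Lp.coeFn_smul z (U i)] with x h1 h2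
    rw [h1, Pi.add_apply, h2, Pi.smul_apply, smul_eq_mul]
  constructor
  · rintro ⟨u, u', u'', hu, hUV⟩
    obtain ⟨A, B, hA, hB, hfa, hfb⟩ := hu.vertexConditions
    have key : ∀ i x (hx : x ∈ Icc (0 : ℝ) 1),
        u (0, i) x = sol (pot hq z) (V i) A (u' (0, i) 0) ⟨x, hx⟩ ∧
        u' (0, i) x = dsol (pot hq z) (V i) A (u' (0, i) 0) ⟨x, hx⟩ := by
      intro i
      rw [← hA i]
      refine (hu.isH2 (0, i)).eq_sol _ _ ?_
      filter_upwards [(hUV i).1, (hUV i).2, hVU i, coeFn_pot hq z] with x h1 h2 h3 h4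
      rw [h4, ← h1]
      rw [h3, ← h1] at h2
      linear_combination h2
    refine ⟨A, B, fun i => u' (0, i) 0, fun i => ?_, fun _ => rfl, fun i => ?_, hfa, ?_⟩
    · refine Lp.ext ?_
      filter_upwards [(hUV i).1, coeFn_mulOp_one2 (sol (pot hq z) (V i) A (u' (0, i) 0)),
        ae_restrict_mem measurableSet_Icc] with x h1 h2 h3
      rw [h2, extend_of_mem _ h3, ← (key i x h3).1]
      exact h1
    · rw [← hB i]
      exact ((key i 1 (by simp)).1).symm
    · rw [← hfb]
      refine Finset.sum_congr rfl fun i _ => ?_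
      simp only [(key i 1 (by simp)).2]
  · rintro ⟨A, B, β, hU, _, hB, hfa, hfb⟩
    have h2 : ∀ i, IsH2 (extend (sol (pot hq z) (V i) A (β i)))
        (extend (dsol (pot hq z) (V i) A (β i)))
        (fun x => (q x - z) * extend (sol (pot hq z) (V i) A (β i)) x - V i x) := fun i => by
      refine isH2_extend_sol _ _ _ _ ?_
      filter_upwards [coeFn_pot hq z] with x h1
      rw [h1]
    refine ⟨_, _, _, isBlochFunction_of_vertexConditions (θ := θ) (A := A) (B := B) h2
      ⟨fun i => extend_sol_zero _ _ _ _, fun i => (extend_one _).trans (hB i), ?_, ?_⟩,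
      fun i => ⟨?_, ?_⟩⟩
    · simp only [extend_dsol_zero, hfa]
    · simp only [extend_one, hfb]
    · filter_upwards [coeFn_mulOp_one2 (sol (pot hq z) (V i) A (β i))] with x h1
      simp only [phase_zero, one_mul, hU i, h1]
    · filter_upwards [coeFn_mulOp_one2 (sol (pot hq z) (V i) A (β i)), hVU i] with x h1 h2
      simp only [phase_zero, one_mul, h2, hU i, h1]
      ring

/-- The solution of `φ'' = w φ - v` with vanishing initial data, as a function of `v`. -/
def partSol (w : L2E) : L2E →L[ℂ] C01 := -(solve w ∘L intOp ∘L mulOp one2 ∘L intOp)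

theorem partSol_apply (w v : L2E) : partSol w v = sol w v 0 0 := by
  have : (0 : ℂ) • (1 : C01) + (0 : ℂ) • intOp one2 - intOp (mulOp one2 (intOp v)) =
      -intOp (mulOp one2 (intOp v)) := by
    ext x
    simp
  rw [sol, this, map_neg]
  rfl

/-- The derivative of `partSol`. -/
def dpartSol (w : L2E) : L2E →L[ℂ] C01 := intOp ∘L (mulOp w ∘L partSol w - .id ℂ L2E)

theorem dpartSol_apply (w v : L2E) : dpartSol w v = dsol w v 0 0 := by
  have : dpartSol w v = intOp (mulOp w (partSol w v) - v) := rfl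
  rw [this, dsol, partSol_apply]
  ext x
  simp

/-- The vertex conditions for solutions of the Hill equation, solved for the derivatives at `0`. -/
theorem vertexConditions_iff {θ : ℝ × ℝ} {A B c s c' s' : ℂ} {p p' β : Bond → ℂ} (hs : s ≠ 0)
    (hw : c * s' - c' * s = 1) :
    VertexConditions θ A B (fun _ => A) (fun i => p i + A * c + β i * s) β
        (fun i => p' i + A * c' + β i * s') ↔
      (∀ i, β i = s⁻¹ * (phase θ (-i.shift) * B - A * c - p i)) ∧
      star (structureFn θ) * B - 3 * c * A = ∑ i, p i ∧
      3 * s' * B - structureFn θ * A =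
        ∑ i : Bond, phase θ i.shift * (s' * p i - s * p' i) := by
  have hβ : ∀ i, (p i + A * c + β i * s = phase θ (-i.shift) * B ↔
      β i = s⁻¹ * (phase θ (-i.shift) * B - A * c - p i)) := fun i => by
    rw [eq_inv_mul_iff_mul_eq₀ hs]
    constructor <;> intro h <;> linear_combination h
  have hsum : ∀ a : ℂ, ∑ _i : Bond, a = 3 * a := fun a => by
    rw [Finset.sum_const, nsmul_eq_mul]; rfl
  have e1 : (∀ i, β i = s⁻¹ * (phase θ (-i.shift) * B - A * c - p i)) →
      s * ∑ i, β i = star (structureFn θ) * B - 3 * c * A - ∑ i, p i := fun h => by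
    simp only [h, ← Finset.mul_sum, Finset.sum_sub_distrib, ← Finset.sum_mul, sum_phase_neg, hsum]
    rw [mul_inv_cancel_left₀ hs]
    ring
  have e2 : (∀ i, β i = s⁻¹ * (phase θ (-i.shift) * B - A * c - p i)) →
      s * ∑ i : Bond, phase θ i.shift * (p' i + A * c' + β i * s') =
        3 * s' * B - structureFn θ * A -
          ∑ i : Bond, phase θ i.shift * (s' * p i - s * p' i) := fun h => by
    -- The Wronskian identity collapses the coefficient `s c' - c s'` of `A` to `-1`; this is why
    -- `F` enters the second equation without a factor from the potential.
    have : ∀ i : Bond, s * (phase θ i.shift * (p' i + A * c' + β i * s')) =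
        s' * B - phase θ i.shift * A - phase θ i.shift * (s' * p i - s * p' i) := fun i => by
      have h1 : s * β i = phase θ (-i.shift) * B - A * c - p i := by
        rw [h i, mul_inv_cancel_left₀ hs]
      linear_combination phase θ i.shift * s' * h1 + s' * B * phase_mul_neg θ i.shift -
        phase θ i.shift * A * hw
    rw [Finset.mul_sum]
    simp only [this, Finset.sum_sub_distrib, ← Finset.sum_mul, hsum, structureFn]
    ring
  constructor
  · rintro ⟨-, hb, hfa, hfb⟩
    have hb' := fun i => (hβ i).1 (hb i)
    have e1' := e1 hb'
    have e2' := e2 hb'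
    rw [hfa] at e1'
    rw [hfb] at e2'
    exact ⟨hb', by linear_combination -e1', by linear_combination -e2'⟩
  · rintro ⟨hb, h1, h2⟩
    refine ⟨fun _ => rfl, fun i => (hβ i).2 (hb i), ?_, ?_⟩
    · refine (mul_eq_zero.1 ((e1 hb).trans ?_)).resolve_left hs
      rw [h1, sub_self]
    · refine (mul_eq_zero.1 ((e2 hb).trans ?_)).resolve_left hs
      rw [h2, sub_self]

variable {z}

theorem mem_blochHamiltonian_iff_linear (hs : sinSol hq z right ≠ 0) (U V : L2W) :
    (U, V + z • U) ∈ blochHamiltonian q θ ↔ ∃ A B : ℂ,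
      (∀ i, U i = mulOp one2 (sol (pot hq z) (V i) A ((sinSol hq z right)⁻¹ *
        (phase θ (-i.shift) * B - A * cosSol hq z right - partSol (pot hq z) (V i) right)))) ∧
      star (structureFn θ) * B - 3 * cosSol hq z right * A =
        ∑ i, partSol (pot hq z) (V i) right ∧
      3 * dsinSol hq z right * B - structureFn θ * A =
        ∑ i : Bond, phase θ i.shift * (dsinSol hq z right * partSol (pot hq z) (V i) right -
          sinSol hq z right * dpartSol (pot hq z) (V i) right) := by
  have e1 : ∀ v A β, sol (pot hq z) v A β right =
      partSol (pot hq z) v right + A * cosSol hq z right + β * sinSol hq z right := by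
    intro v A β
    rw [sol_linear, partSol_apply]
    rfl
  have e2 : ∀ v A β, dsol (pot hq z) v A β right =
      dpartSol (pot hq z) v right + A * dcosSol hq z right + β * dsinSol hq z right := by
    intro v A β
    rw [dsol_linear, dpartSol_apply]
    rfl
  rw [mem_blochHamiltonian_iff hq]
  simp only [e1, e2]
  constructor
  · rintro ⟨A, B, β, hU, hvc⟩
    obtain ⟨hβ, h1, h2⟩ := (vertexConditions_iff hs (wronskian hq z)).1 hvc
    exact ⟨A, B, fun i => by rw [hU i, hβ i], h1, h2⟩
  · rintro ⟨A, B, hU, h1, h2⟩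
    exact ⟨A, B, _, hU, (vertexConditions_iff hs (wronskian hq z)).2 ⟨fun _ => rfl, h1, h2⟩⟩

/-- A vanishing determinant gives vertex values `(A, B) ≠ 0` solving the homogeneous system. A
resolvent would force the resulting eigenfunction to be zero, and then `A` and `B` would vanish too.
-/
theorem mem_spectrum_of_dispersion (hs : sinSol hq z right ≠ 0)
    (h : structureFn θ * star (structureFn θ) =
      9 * cosSol hq z right * dsinSol hq z right) :
    z ∈ operatorSpectrum (blochHamiltonian q θ) := by
  rintro ⟨R, hR⟩
  obtain ⟨x, hx0, hx⟩ := (Matrix.exists_mulVec_eq_zero_iff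
    (M := !![-3 * cosSol hq z right, star (structureFn θ);
      -structureFn θ, 3 * dsinSol hq z right])).2 (by
    rw [Matrix.det_fin_two_of]
    linear_combination h)
  have hx1 := congrFun hx 0
  have hx2 := congrFun hx 1
  simp [Matrix.mulVec, dotProduct] at hx1 hx2
  let β : Bond → ℂ := fun i => (sinSol hq z right)⁻¹ *
        (phase θ (-i.shift) * x 1 - x 0 * cosSol hq z right - partSol (pot hq z) 0 right)
  let U : L2W := WithLp.toLp 2 fun i => mulOp one2 (sol (pot hq z) 0 (x 0) (β i))
  have hU : (U, (0 : L2W) + z • U) ∈ blochHamiltonian q θ := by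
    refine (mem_blochHamiltonian_iff_linear hq θ hs U 0).2 ⟨x 0, x 1, fun i => rfl, ?_, ?_⟩
    · simp
      linear_combination hx1
    · simp
      linear_combination hx2
  have h0 : ((0 : L2W), (0 : L2W) + z • (0 : L2W)) ∈ blochHamiltonian q θ := by
    refine (mem_blochHamiltonian_iff_linear hq θ hs 0 0).2 ⟨0, 0, fun i => ?_, ?_, ?_⟩
    · simp [sol_homogeneous_zero]
    · simp
    · simp
  have hU0 : U = 0 := by rw [(hR U 0).1 hU, ← (hR 0 0).1 h0]
  have hsol : ∀ i, sol (pot hq z) 0 (x 0) (β i) = 0 := fun i => by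
    apply eq_of_mulOp_one2_eq
    rw [map_zero]
    exact congrArg (fun W : L2W => W i) hU0
  have hA : x 0 = 0 := by
    rw [← sol_zero (pot hq z) 0 (x 0) (β .f), hsol]
    rfl
  have hβ : β .f = 0 := by
    have h1 := hsol .f
    rw [sol_linear, sol_homogeneous_zero, hA] at h1
    have h2 := congrArg (fun φ : C01 => φ right) h1
    have h3 : 0 + 0 * cosSol hq z right + β .f * sinSol hq z right = 0 := h2
    rw [zero_mul, add_zero, zero_add] at h3
    exact (mul_eq_zero.1 h3).resolve_right hs
  -- On the edge `f` the phase is `1`, so with `A = 0` the vanishing slope is `B / s`.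
  have hB : x 1 = 0 := by
    have := (mul_eq_zero.1 hβ).resolve_left (inv_ne_zero hs)
    rw [hA] at this
    have e : phase θ (-Bond.f.shift) = 1 := by
      rw [show -Bond.f.shift = 0 from rfl, phase_zero]
    simpa [e] using this
  exact hx0 (by ext i; fin_cases i <;> assumption)

/-- If the determinant is nonzero, Cramer's rule expresses `A` and `B` as bounded functionals of
`V`, and substituting them into the solution formula builds a bounded resolvent. -/
theorem dispersion_of_mem_spectrum (hs : sinSol hq z right ≠ 0)
    (h : z ∈ operatorSpectrum (blochHamiltonian q θ)) :
    structureFn θ * star (structureFn θ) = 9 * cosSol hq z right * dsinSol hq z right := by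
  by_contra hne
  apply h
  set c := cosSol hq z right
  set s := sinSol hq z right
  set s' := dsinSol hq z right
  set F := structureFn θ
  set Δ := F * star F - 9 * c * s' with hΔ
  have hΔ0 : Δ ≠ 0 := sub_ne_zero.2 hne
  let pr : Bond → L2W →L[ℂ] L2E := fun i => PiLp.proj 2 (fun _ : Bond => L2E) i
  let ev : C01 →L[ℂ] ℂ := ContinuousMap.evalCLM ℂ right
  let p : Bond → L2W →L[ℂ] ℂ := fun i => ev ∘L partSol (pot hq z) ∘L pr i
  let p' : Bond → L2W →L[ℂ] ℂ := fun i => ev ∘L dpartSol (pot hq z) ∘L pr i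
  let P : L2W →L[ℂ] ℂ := ∑ i, p i
  let N : L2W →L[ℂ] ℂ := ∑ i : Bond, phase θ i.shift • (s' • p i - s • p' i)
  let A : L2W →L[ℂ] ℂ := Δ⁻¹ • ((3 * s') • P - star F • N)
  let B : L2W →L[ℂ] ℂ := Δ⁻¹ • (F • P - (3 * c) • N)
  let β : Bond → L2W →L[ℂ] ℂ := fun i => s⁻¹ • (phase θ (-i.shift) • B - c • A - p i)
  let r : Bond → L2W →L[ℂ] L2E := fun i => mulOp one2 ∘L (partSol (pot hq z) ∘L pr i +
    (A.smulRight (cosSol hq z) + (β i).smulRight (sinSol hq z)))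
  let R : L2W →L[ℂ] L2W :=
    (PiLp.continuousLinearEquiv 2 ℂ (fun _ : Bond => L2E)).symm.toContinuousLinearMap ∘L
      ContinuousLinearMap.pi r
  have hP : ∀ V : L2W, P V = ∑ i, partSol (pot hq z) (V i) right := fun V => by
    simp only [P, sum_apply]
    rfl
  have hN : ∀ V : L2W, N V = ∑ i : Bond, phase θ i.shift *
      (s' * partSol (pot hq z) (V i) right - s * dpartSol (pot hq z) (V i) right) := fun V => by
    simp only [N, sum_apply]
    rfl
  have hA : ∀ V, Δ * A V = 3 * s' * P V - star F * N V := fun V => by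
    change Δ * (Δ⁻¹ * (3 * s' * P V - star F * N V)) = _
    rw [mul_inv_cancel_left₀ hΔ0]
  have hB : ∀ V, Δ * B V = F * P V - 3 * c * N V := fun V => by
    change Δ * (Δ⁻¹ * (F * P V - 3 * c * N V)) = _
    rw [mul_inv_cancel_left₀ hΔ0]
  have hR : ∀ V i, R V i = mulOp one2 (sol (pot hq z) (V i) (A V) (s⁻¹ *
      (phase θ (-i.shift) * B V - A V * c - partSol (pot hq z) (V i) right))) := fun V i => by
    rw [sol_linear, mul_comm (A V) c, ← partSol_apply, add_assoc]
    rfl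
  refine ⟨R, fun U V => ?_⟩
  rw [mem_blochHamiltonian_iff_linear hq θ hs U V, ← hP, ← hN]
  constructor
  · rintro ⟨A₀, B₀, hU, h1, h2⟩
    have hA₀ : A₀ = A V := by
      apply mul_left_cancel₀ hΔ0
      rw [hA, hΔ]
      linear_combination 3 * s' * h1 - star F * h2
    have hB₀ : B₀ = B V := by
      apply mul_left_cancel₀ hΔ0
      rw [hB, hΔ]
      linear_combination F * h1 - 3 * c * h2
    refine PiLp.ext fun i => ?_
    rw [hU i, hR V i, hA₀, hB₀]
  · rintro rfl
    refine ⟨A V, B V, hR V, ?_, ?_⟩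
    · apply mul_left_cancel₀ hΔ0
      linear_combination star F * hB V - 3 * c * hA V - P V * hΔ
    · apply mul_left_cancel₀ hΔ0
      linear_combination 3 * s' * hB V - F * hA V - N V * hΔ

theorem mem_spectrum_iff (hs : sinSol hq z right ≠ 0) :
    z ∈ operatorSpectrum (blochHamiltonian q θ) ↔
      structureFn θ * star (structureFn θ) = 9 * cosSol hq z right * dsinSol hq z right :=
  ⟨dispersion_of_mem_spectrum hq θ hs, mem_spectrum_of_dispersion hq θ hs⟩

end Spectrum

/-! ### The structure function near its zeros -/

theorem structureFn_eq (θ : ℝ × ℝ) :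
    structureFn θ = 1 + Complex.exp (Complex.I * θ.1) + Complex.exp (Complex.I * θ.2) := by
  have : (Finset.univ : Finset Bond) = {.f, .g, .h} := rfl
  rw [structureFn, this, Finset.sum_insert (by simp), Finset.sum_insert (by simp),
    Finset.sum_singleton]
  simp [phase, Bond.shift, add_assoc]

theorem cos_two_pi_div_three : Real.cos (2 * π / 3) = -(1 / 2) := by
  rw [show 2 * π / 3 = π - π / 3 by ring, Real.cos_pi_sub, Real.cos_pi_div_three]

theorem sin_two_pi_div_three : Real.sin (2 * π / 3) = √3 / 2 := by
  rw [show 2 * π / 3 = π - π / 3 by ring, Real.sin_pi_sub, Real.sin_pi_div_three]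

theorem exp_I_mul (t : ℝ) :
    Complex.exp (Complex.I * t) = Real.cos t + Real.sin t * Complex.I := by
  rw [mul_comm, Complex.exp_mul_I, Complex.ofReal_cos, Complex.ofReal_sin]

theorem structureFn_eq_zero_iff_cos_sin (θ : ℝ × ℝ) : structureFn θ = 0 ↔
    1 + Real.cos θ.1 + Real.cos θ.2 = 0 ∧ Real.sin θ.1 + Real.sin θ.2 = 0 := by
  rw [structureFn_eq, exp_I_mul, exp_I_mul, Complex.ext_iff]
  simp only [Complex.add_re, Complex.add_im, Complex.mul_re, Complex.mul_im, Complex.ofReal_re,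
    Complex.ofReal_im, Complex.I_re, Complex.I_im, Complex.one_re, Complex.one_im,
    Complex.zero_re, Complex.zero_im]
  ring_nf

theorem abs_eq_of_cos_eq {t : ℝ} (ht : t ∈ Icc (-π) π) (h : Real.cos t = -(1 / 2)) :
    t = 2 * π / 3 ∨ t = -(2 * π / 3) := by
  have hpi := Real.pi_pos
  rw [← Real.cos_abs, ← cos_two_pi_div_three] at h
  exact eq_or_eq_neg_of_abs_eq (Real.injOn_cos ⟨abs_nonneg t, abs_le.2 ht⟩
    ⟨by positivity, by linarith⟩ h)

/-- The two quasimomenta at which the structure function vanishes. -/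
def IsDiracPoint (θ : ℝ × ℝ) : Prop :=
  θ = (2 * π / 3, -(2 * π / 3)) ∨ θ = (-(2 * π / 3), 2 * π / 3)

theorem structureFn_eq_zero_iff {θ : ℝ × ℝ} (hθ : θ ∈ brillouinZone) :
    structureFn θ = 0 ↔ IsDiracPoint θ := by
  rw [structureFn_eq_zero_iff_cos_sin]
  constructor
  · rintro ⟨h1, h2⟩
    have e1 := Real.sin_sq_add_cos_sq θ.1
    have e2 := Real.sin_sq_add_cos_sq θ.2
    -- Three unit vectors with sum zero: opposite sines make the squared cosines equal, so `cos² θ₁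
    -- = (1 + cos θ₁)²`.
    have c1 : Real.cos θ.1 = -(1 / 2) := by
      have : Real.sin θ.2 = -Real.sin θ.1 := by linarith
      have h' : Real.cos θ.2 = -1 - Real.cos θ.1 := by linarith
      rw [this, h'] at e2
      nlinarith
    have c2 : Real.cos θ.2 = -(1 / 2) := by linarith
    have hs : 0 < Real.sin (2 * π / 3) := by rw [sin_two_pi_div_three]; positivity
    rcases abs_eq_of_cos_eq hθ.1 c1 with h | h <;> rcases abs_eq_of_cos_eq hθ.2 c2 with k | k
    · rw [h, k] at h2; linarith
    · exact Or.inl (Prod.ext h k)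
    · exact Or.inr (Prod.ext h k)
    · rw [h, k, Real.sin_neg] at h2; linarith
  · rintro (rfl | rfl) <;> simp only [Real.cos_neg, Real.sin_neg, cos_two_pi_div_three] <;>
      constructor <;> ring

/-- Both points are interior, so the restriction to the Brillouin zone is invisible locally. -/
theorem IsDiracPoint.brillouinZone_mem_nhds {θ : ℝ × ℝ} (h : IsDiracPoint θ) :
    brillouinZone ∈ 𝓝 θ := by
  have hpi := Real.pi_pos
  rcases h with rfl | rfl <;>
    exact prod_mem_nhds (Icc_mem_nhds (by linarith) (by linarith))
      (Icc_mem_nhds (by linarith) (by linarith))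

theorem IsDiracPoint.structureFn_eq_zero {θ : ℝ × ℝ} (h : IsDiracPoint θ) : structureFn θ = 0 :=
  (structureFn_eq_zero_iff (mem_of_mem_nhds h.brillouinZone_mem_nhds)).2 h

theorem IsDiracPoint.eventually_structureFn_ne_zero {θ₀ : ℝ × ℝ} (h : IsDiracPoint θ₀) :
    ∀ᶠ θ in 𝓝[≠] θ₀, structureFn θ ≠ 0 := by
  have hfin : ({(2 * π / 3, -(2 * π / 3)), (-(2 * π / 3), 2 * π / 3)} : Set (ℝ × ℝ)).Finite := by
    simp
  have h1 := (hfin.subset (sdiff_subset (t := {θ₀}))).isClosed.isOpen_compl.mem_nhds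
    (x := θ₀) (by simp)
  filter_upwards [nhdsWithin_le_nhds h1, nhdsWithin_le_nhds h.brillouinZone_mem_nhds,
    self_mem_nhdsWithin] with θ ha hb hc h0
  exact ha ⟨(structureFn_eq_zero_iff hb).1 h0, hc⟩

/-- The differential of the structure function at `θ₀`. -/
def structureDiff (θ₀ h : ℝ × ℝ) : ℂ :=
  Complex.exp (Complex.I * θ₀.1) * (Complex.I * h.1) +
    Complex.exp (Complex.I * θ₀.2) * (Complex.I * h.2)

theorem structureFn_sub_isBigO (θ₀ : ℝ × ℝ) (h₀ : structureFn θ₀ = 0) :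
    (fun θ => structureFn θ - structureDiff θ₀ (θ - θ₀)) =O[𝓝 θ₀] fun θ => ‖θ - θ₀‖ ^ 2 := by
  refine IsBigO.of_bound 2 ?_
  filter_upwards [Metric.ball_mem_nhds θ₀ one_pos] with θ hθ
  rw [Metric.mem_ball, dist_eq_norm] at hθ
  have key : ∀ s t : ℝ, |t - s| ≤ ‖θ - θ₀‖ →
      ‖Complex.exp (Complex.I * t) - Complex.exp (Complex.I * s) -
        Complex.exp (Complex.I * s) * (Complex.I * (t - s : ℝ))‖ ≤ ‖θ - θ₀‖ ^ 2 := by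
    intro s t hst
    have e : Complex.exp (Complex.I * t) - Complex.exp (Complex.I * s) -
        Complex.exp (Complex.I * s) * (Complex.I * (t - s : ℝ)) =
        Complex.exp (Complex.I * s) * (Complex.exp (Complex.I * (t - s : ℝ)) - 1 -
          Complex.I * (t - s : ℝ)) := by
      have : Complex.exp (Complex.I * t) =
          Complex.exp (Complex.I * s) * Complex.exp (Complex.I * (t - s : ℝ)) := by
        rw [← Complex.exp_add]
        congr 1
        push_cast
        ring
      rw [this]
      ring
    have hn : ‖Complex.I * ((t - s : ℝ) : ℂ)‖ = |t - s| := by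
      rw [norm_mul, Complex.norm_I, one_mul, Complex.norm_real, Real.norm_eq_abs]
    rw [e, norm_mul, mul_comm Complex.I (s : ℂ), Complex.norm_exp_ofReal_mul_I, one_mul]
    refine (Complex.norm_exp_sub_one_sub_id_le (by rw [hn]; linarith)).trans ?_
    rw [hn]
    gcongr
  have h1 := key θ₀.1 θ.1 (norm_fst_le (θ - θ₀))
  have h2 := key θ₀.2 θ.2 (norm_snd_le (θ - θ₀))
  have e : structureFn θ - structureDiff θ₀ (θ - θ₀) =
      (Complex.exp (Complex.I * θ.1) - Complex.exp (Complex.I * θ₀.1) -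
        Complex.exp (Complex.I * θ₀.1) * (Complex.I * (θ.1 - θ₀.1 : ℝ))) +
      (Complex.exp (Complex.I * θ.2) - Complex.exp (Complex.I * θ₀.2) -
        Complex.exp (Complex.I * θ₀.2) * (Complex.I * (θ.2 - θ₀.2 : ℝ))) := by
    rw [structureFn_eq] at h₀ ⊢
    simp only [structureDiff, Prod.fst_sub, Prod.snd_sub]
    linear_combination h₀
  rw [e, norm_pow, norm_norm]
  refine (norm_add_le _ _).trans ?_
  linarith

theorem IsDiracPoint.norm_sq_structureDiff {θ₀ : ℝ × ℝ} (h : IsDiracPoint θ₀) (x : ℝ × ℝ) :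
    ‖structureDiff θ₀ x‖ ^ 2 = x.1 * x.1 - x.1 * x.2 + x.2 * x.2 := by
  rw [Complex.sq_norm, Complex.normSq_apply]
  have h3 : √3 * √3 = 3 := Real.mul_self_sqrt (by norm_num)
  rcases h with rfl | rfl <;>
  · simp only [structureDiff, exp_I_mul, Complex.add_re, Complex.add_im, Complex.mul_re,
      Complex.mul_im, Complex.ofReal_re, Complex.ofReal_im, Complex.I_re, Complex.I_im,
      Real.cos_neg, Real.sin_neg, cos_two_pi_div_three, sin_two_pi_div_three]
    linear_combination ((x.1 - x.2) ^ 2 / 4) * h3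

theorem contDiff_structureFn : ContDiff ℝ ω structureFn := by
  have : structureFn = fun θ : ℝ × ℝ => 1 + Complex.exp (Complex.I * Complex.ofRealCLM θ.1) +
      Complex.exp (Complex.I * Complex.ofRealCLM θ.2) := funext structureFn_eq
  rw [this]
  fun_prop

/-! ### Local inverses -/

/-- The last clause holds on a full neighbourhood in the product, which is what lets the level
equation be solved for `λ` near the apex. -/
theorem exists_local_inverse {η : ℝ → ℝ} {l d : ℝ} (hη : ContDiff ℝ ω η) (hl : η l = 0)
    (hd : HasDerivAt η d l) (hd0 : d ≠ 0) :
    ∃ g : ℝ → ℝ, ContDiffAt ℝ ω g 0 ∧ g 0 = l ∧ HasDerivAt g d⁻¹ 0 ∧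
      ∀ᶠ x : ℝ × ℝ in 𝓝 (l, 0), η x.1 = x.2 ↔ x.1 = g x.2 := by
  have hf' : HasFDerivAt η
      ((ContinuousLinearEquiv.unitsEquivAut ℝ (Units.mk0 d hd0) : ℝ ≃L[ℝ] ℝ) : ℝ →L[ℝ] ℝ) l := by
    convert! hd.hasFDerivAt using 1
  have hn : (ω : WithTop ℕ∞) ≠ 0 := by simp
  have hs := hη.contDiffAt.hasStrictFDerivAt' hf' hn
  refine ⟨hη.contDiffAt.localInverse hf' hn, ?_, ?_, ?_, ?_⟩
  · have := hη.contDiffAt.to_localInverse hf' hn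
    rwa [hl] at this
  · rw [← hl]
    exact hη.contDiffAt.localInverse_apply_image hf' hn
  · have := hs.to_localInverse.hasFDerivAt.hasDerivAt
    rw [hl] at this
    convert! this using 1
    simp
  · have h1 := hs.eventually_left_inverse
    have h2 := hs.eventually_right_inverse
    rw [hl] at h2
    filter_upwards [(h1.prod_inl_nhds 0), (h2.prod_inr_nhds l)] with x hx1 hx2
    constructor
    · intro h
      rw [← h]
      exact hx1.symm
    · intro h
      rw [h]
      exact hx2

theorem sub_linear_isBigO {g : ℝ → ℝ} {k : ℝ} (hg : ContDiffAt ℝ ω g 0) (hk : HasDerivAt g k 0) :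
    (fun y => g y - (g 0 + k * y)) =O[𝓝 0] fun y => y ^ 2 := by
  obtain ⟨p, hp⟩ := hg.analyticAt
  have h := hp.isBigO_sub_partialSum_pow 2
  have h1 : p 1 (fun _ => 1) = k := hp.hasDerivAt.unique hk
  have h0 : ∀ v, p 0 v = g 0 := hp.coeff_zero
  simp only [zero_add, FormalMultilinearSeries.partialSum, Finset.sum_range_succ,
    Finset.sum_range_zero, h0] at h
  refine (h.congr_left fun y => ?_).trans (isBigO_of_le _ fun y => by simp)
  congr 2
  rw [FormalMultilinearSeries.apply_eq_pow_smul_coeff, FormalMultilinearSeries.coeff]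
  change y ^ 1 * p 1 (fun _ => 1) = _
  rw [h1, pow_one, mul_comm]

/-! ### Conical singularities -/

/-- The quadratic form `κ² (x₁² - x₁ x₂ + x₂²)`. -/
def coneForm (κ : ℝ) : QuadraticForm ℝ (ℝ × ℝ) :=
  κ ^ 2 • (QuadraticMap.linMulLin (LinearMap.fst ℝ ℝ ℝ) (LinearMap.fst ℝ ℝ ℝ) -
    QuadraticMap.linMulLin (LinearMap.fst ℝ ℝ ℝ) (LinearMap.snd ℝ ℝ ℝ) +
    QuadraticMap.linMulLin (LinearMap.snd ℝ ℝ ℝ) (LinearMap.snd ℝ ℝ ℝ))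

theorem coneForm_apply (κ : ℝ) (x : ℝ × ℝ) :
    coneForm κ x = κ ^ 2 * (x.1 * x.1 - x.1 * x.2 + x.2 * x.2) := rfl

theorem posDef_coneForm {κ : ℝ} (hκ : κ ≠ 0) : (coneForm κ).PosDef := by
  intro x hx
  rw [coneForm_apply]
  refine mul_pos (by positivity) ?_
  by_contra hle
  have h1 : x.1 ^ 2 + x.2 ^ 2 ≤ 0 := by nlinarith [sq_nonneg (x.1 - x.2)]
  have h2 : x.1 = 0 := by nlinarith [sq_nonneg x.1, sq_nonneg x.2]
  have h3 : x.2 = 0 := by nlinarith [sq_nonneg x.1, sq_nonneg x.2]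
  exact hx (Prod.ext h2 h3)

theorem IsDiracPoint.sqrt_coneForm {θ₀ : ℝ × ℝ} (h : IsDiracPoint θ₀) (κ : ℝ) (x : ℝ × ℝ) :
    √(coneForm κ x) = |κ| * ‖structureDiff θ₀ x‖ := by
  rw [coneForm_apply, ← h.norm_sq_structureDiff, Real.sqrt_mul (sq_nonneg κ), Real.sqrt_sq_eq_abs,
    Real.sqrt_sq (norm_nonneg _)]

/-- Two quadratic errors add up: the Taylor remainder of `g` at `c|F|`, where `F = O(|θ - θ₀|)`, and
the replacement of `|F|` by the modulus of its differential. -/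
theorem IsDiracPoint.branch_isBigO {θ₀ : ℝ × ℝ} (h : IsDiracPoint θ₀) {g : ℝ → ℝ} {k : ℝ}
    (hg : ContDiffAt ℝ ω g 0) (hk : HasDerivAt g k 0) (c : ℝ) :
    (fun θ => g (c * ‖structureFn θ‖) - (g 0 + k * c * ‖structureDiff θ₀ (θ - θ₀)‖))
      =O[𝓝 θ₀] fun θ => ‖θ - θ₀‖ ^ 2 := by
  have hF := structureFn_sub_isBigO θ₀ h.structureFn_eq_zero
  have hn : (fun θ => ‖structureFn θ‖ - ‖structureDiff θ₀ (θ - θ₀)‖)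
      =O[𝓝 θ₀] fun θ => ‖θ - θ₀‖ ^ 2 :=
    (isBigO_of_le _ fun θ => abs_norm_sub_norm_le _ _).trans hF
  have hlin : structureFn =O[𝓝 θ₀] fun θ => ‖θ - θ₀‖ := by
    have := (contDiff_structureFn.differentiable (by simp) θ₀).isBigO_sub
    simp only [h.structureFn_eq_zero, sub_zero] at this
    exact this.norm_right
  have htend : Tendsto (fun θ => c * ‖structureFn θ‖) (𝓝 θ₀) (𝓝 0) := by
    have : Continuous fun θ => c * ‖structureFn θ‖ :=
      continuous_const.mul contDiff_structureFn.continuous.norm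
    simpa [h.structureFn_eq_zero] using this.tendsto θ₀
  have h1 := (sub_linear_isBigO hg hk).comp_tendsto htend
  have h2 : ((fun y : ℝ => y ^ 2) ∘ fun θ => c * ‖structureFn θ‖)
      =O[𝓝 θ₀] fun θ => ‖θ - θ₀‖ ^ 2 :=
    (hlin.norm_left.const_mul_left c).pow 2
  refine ((h1.trans h2).add (hn.const_mul_left (k * c))).congr_left fun θ => ?_
  simp only [Function.comp_apply]
  ring

/-- The modulus is smooth away from zero, and the zero of `F` at `θ₀` is isolated. -/
theorem IsDiracPoint.eventually_contDiffAt_branch {θ₀ : ℝ × ℝ} (h : IsDiracPoint θ₀) {g : ℝ → ℝ}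
    (hg : ContDiffAt ℝ ω g 0) (c : ℝ) :
    ∀ᶠ θ in 𝓝[≠] θ₀, ContDiffAt ℝ ∞ (fun θ => g (c * ‖structureFn θ‖)) θ := by
  have htend : Tendsto (fun θ => c * ‖structureFn θ‖) (𝓝 θ₀) (𝓝 0) := by
    have : Continuous fun θ => c * ‖structureFn θ‖ :=
      continuous_const.mul contDiff_structureFn.continuous.norm
    simpa [h.structureFn_eq_zero] using this.tendsto θ₀
  filter_upwards [nhdsWithin_le_nhds (htend.eventually (hg.eventually (by simp))),
    h.eventually_structureFn_ne_zero] with θ h1 h2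
  have h3 : ContDiffAt ℝ ω (fun θ => c * ‖structureFn θ‖) θ :=
    contDiffAt_const.mul (contDiff_structureFn.contDiffAt.norm ℝ h2)
  exact (ContDiffAt.comp θ h1 h3).of_le le_top

theorem mem_dispersionRelation_iff {q : ℝ → ℝ} (hq : MemLp q 2 edgeMeasure)
    (heven : ∀ᵐ x ∂edgeMeasure, q (1 - x) = q x) {l : ℝ} {θ : ℝ × ℝ}
    (hs : sinSol hq l right ≠ 0) :
    (θ, l) ∈ dispersionRelation q ↔ θ ∈ brillouinZone ∧
      (eta hq l = 1 / 3 * ‖structureFn θ‖ ∨ eta hq l = -(1 / 3) * ‖structureFn θ‖) := by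
  refine and_congr_right fun _ => ?_
  rw [mem_spectrum_iff hq θ hs, ← cosSol_eq_dsinSol hq heven hs, ← ofReal_eta, Complex.star_def,
    Complex.mul_conj']
  have : (‖structureFn θ‖ : ℂ) ^ 2 = 9 * eta hq l * eta hq l ↔
      ‖structureFn θ‖ ^ 2 = (3 * eta hq l) ^ 2 := by
    rw [← Complex.ofReal_inj]
    push_cast
    ring_nf
  rw [this, eq_comm, sq_eq_sq_iff_eq_or_eq_neg]
  constructor <;> rintro (h | h)
  · left; linarith
  · right; linarith
  · left; linarith
  · right; linarith

theorem hasConicalSingularity_of_isDiracPoint {q : ℝ → ℝ} (hq : MemLp q 2 edgeMeasure)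
    (heven : ∀ᵐ x ∂edgeMeasure, q (1 - x) = q x) {l : ℝ} {θ₀ : ℝ × ℝ}
    (hl : discriminant q l = 0) (hθ : IsDiracPoint θ₀) :
    HasConicalSingularity (dispersionRelation q) θ₀ l := by
  have hη0 : eta hq l = 0 := by
    rw [← Complex.ofReal_inj, ofReal_eta, cosSol_eq_zero hq heven hl, Complex.ofReal_zero]
  have hd : HasDerivAt (eta hq) (deriv (eta hq) l) l :=
    ((contDiff_eta hq).differentiable (by simp) l).hasDerivAt
  have hd0 := eta_deriv_ne_zero hq l hη0 hd
  obtain ⟨g, hg, hg0, hgd, hginv⟩ := exists_local_inverse (contDiff_eta hq) hη0 hd hd0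
  set k := (deriv (eta hq) l)⁻¹ with hk
  have hk0 : k ≠ 0 := inv_ne_zero hd0
  -- The sign of `ε` follows that of `g'(0) = 1 / η'(l)`, so that `g(ε|F|)` is the upper sheet
  -- whether `η` increases or decreases at `l`.
  obtain ⟨ε, hε, hεk⟩ : ∃ ε : ℝ, (ε = 1 / 3 ∨ ε = -(1 / 3)) ∧ k * ε = |k / 3| := by
    rcases le_total 0 k with h | h
    · exact ⟨1 / 3, Or.inl rfl, by rw [abs_of_nonneg (by positivity)]; ring⟩
    · exact ⟨-(1 / 3), Or.inr rfl, by rw [abs_of_nonpos (by linarith)]; ring⟩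
  refine ⟨coneForm (k / 3), fun θ => g (ε * ‖structureFn θ‖), fun θ => g (-ε * ‖structureFn θ‖),
    posDef_coneForm (by positivity), ?_, ?_, ?_, ?_⟩
  · refine (hθ.branch_isBigO hg hgd ε).congr_left fun θ => ?_
    rw [hθ.sqrt_coneForm, hg0, hεk]
  · refine (hθ.branch_isBigO hg hgd (-ε)).congr_left fun θ => ?_
    rw [hθ.sqrt_coneForm, hg0, ← hεk]
    ring
  · exact (hθ.eventually_contDiffAt_branch hg ε).and (hθ.eventually_contDiffAt_branch hg (-ε))
  -- The spectral criterion needs `s ≠ 0` at all levels near `l`; continuity in the level provides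
  -- it.
  · have hs : ∀ᶠ y : ℝ in 𝓝 l, sinSol hq y right ≠ 0 := by
      have hc : Continuous fun y : ℝ => sinSol hq (y : ℂ) right :=
        (contDiff_eval_sol_pot hq 0 1 right).continuous.comp Complex.continuous_ofReal
      exact hc.continuousAt.eventually_ne (sinSol_ne_zero hq heven hl)
    have ht : ∀ c : ℝ, Tendsto (fun x : (ℝ × ℝ) × ℝ => (x.2, c * ‖structureFn x.1‖))
        (𝓝 (θ₀, l)) (𝓝 (l, 0)) := fun c => by
      have : Continuous fun x : (ℝ × ℝ) × ℝ => (x.2, c * ‖structureFn x.1‖) :=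
        continuous_snd.prodMk (continuous_const.mul
          (contDiff_structureFn.continuous.comp continuous_fst).norm)
      simpa [hθ.structureFn_eq_zero] using this.tendsto (θ₀, l)
    filter_upwards [hs.prod_inr_nhds θ₀,
      Eventually.prod_inl_nhds (p := fun θ => θ ∈ brillouinZone) hθ.brillouinZone_mem_nhds l,
      (ht (1 / 3)).eventually hginv, (ht (-(1 / 3))).eventually hginv] with x h1 h2 h3 h4
    have e := mem_dispersionRelation_iff hq heven (l := x.2) (θ := x.1) h1
    rw [h3, h4] at e
    refine e.trans ((and_iff_right h2).trans ?_)
    rcases hε with rfl | rfl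
    · rfl
    · rw [neg_neg, or_comm]

theorem isDiracPoint_of_hasConicalSingularity {q : ℝ → ℝ} (hq : MemLp q 2 edgeMeasure)
    (heven : ∀ᵐ x ∂edgeMeasure, q (1 - x) = q x) {l : ℝ} {θ₀ : ℝ × ℝ}
    (hl : discriminant q l = 0)
    (h : HasConicalSingularity (dispersionRelation q) θ₀ l) : IsDiracPoint θ₀ := by
  obtain ⟨Q, lp, lm, -, hlp, -, -, hS⟩ := h
  have hη0 : eta hq l = 0 := by
    rw [← Complex.ofReal_inj, ofReal_eta, cosSol_eq_zero hq heven hl, Complex.ofReal_zero]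
  -- The error bound vanishes at `θ₀` itself, so it determines the value of `lp` there.
  have hlp0 : lp θ₀ = l := by
    have := hlp.eq_zero_of_norm_pow (x₀ := θ₀) (n := 2) (by norm_num)
    simpa [sub_eq_zero] using this
  have hmem : (θ₀, l) ∈ dispersionRelation q := hS.self_of_nhds.2 (Or.inl hlp0.symm)
  rw [mem_dispersionRelation_iff hq heven (sinSol_ne_zero hq heven hl), hη0] at hmem
  refine (structureFn_eq_zero_iff hmem.1).1 (norm_eq_zero.1 ?_)
  rcases hmem.2 with h | h <;> linarith

end Graphene

end

theorem mainTheorem5 (q : ℝ → ℝ) (hq : MemLp q 2 Graphene.edgeMeasure)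
    (hq_even : ∀ᵐ x ∂Graphene.edgeMeasure, q (1 - x) = q x)
    (l : ℝ) (hl : Graphene.discriminant q (l : ℂ) = 0) (θ : ℝ × ℝ) :
    Graphene.HasConicalSingularity (Graphene.dispersionRelation q) θ l ↔
      θ = (2 * π / 3, -(2 * π / 3)) ∨ θ = (-(2 * π / 3), 2 * π / 3) :=
  ⟨Graphene.isDiracPoint_of_hasConicalSingularity hq hq_even hl,
    Graphene.hasConicalSingularity_of_isDiracPoint hq hq_even hl⟩
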